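/- **Network.** Slots are $t=0,1,2,\dots$; the nodes are $\Omega=\{0,1,\dots,N\}$, with $0$ the destination. $S_i(t)\ni i$ is the random set of nodes that have the packet transmitted by $i$ in slot $t$; it has law $P(\cdot\mid i)$. The arrivals $A_i(t)\ge 0$ are bounded, identically distributed over time, and have mean $\lambda_i$; the pairs $(A(t),S(t))$ are independent over time and independent of the initial backlogs, which are non-negative and square integrable. A routing policy is a non-anticipating choice of $\mu_{ij}(t)\in\{0,1\}$ with $\mu_{ij}(t)\le \mathbf 1_{\{j\in S_i(t)\}}$, $\sum_j\mu_{ij}(t)\le1$, and $\mu_{i0}(t)=1$ if $0\in S_i(t)$. The backlogs satisfy $Q_0(t)=0$ and, for $i\neq 0$, $$Q_i(t+1)=\Big[Q_i(t)-\sum_j\mu_{ij}(t)\Big]^++\sum_j\mu_{ji}(t)\mathbf 1_{\{Q_j(t)\ge\mu_{ji}(t)\}}+A_i(t).$$ The policy stabilizes the network if $\limsup_T\frac1T\sum_{t<T}\mathbb E\,Q_i(t)<\infty$ for all $i$. The stability region is the set of vectors $\lambda\in\mathbb R^N_+$ such that, whatever the arrivals (with rate $\lambda$) and initial backlogs as above,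 some routing policy stabilizes the network. A policy is throughput optimal if it stabilizes the network for every $\lambda$ in the interior of the stability region. **Priority-based policies.** A rank ordering $R=(C_1,\dots,C_M)$ is an ordered partition of $\{1,\dots,N\}$ into non-empty classes; $a\prec^R b$ means that $a\in C_i$, $b\in C_j$ with $i<j$. $R'$ is a refinement of $R$ if $a\prec^R b$ implies $a\prec^{R'}b$. Under the priority-based policy with orderings $R(t)$, each node $i$ selects in slot $t$ one node of lowest rank in $S_i(t)$, where the destination ranks lowest of all. Such a policy with orderings $R'(t)$ respects the one with orderings $R(t)$ if $R'(t)$ is a refinement of $R(t)$ for all $t$. *Backpressure* is priority-based routing with orderings $R_b(t)$ such that $Q_i(t)<Q_j(t)$ implies $i\prec^{R_b(t)}j$. In *DIVBAR*, if $0\notin S_i(t)$, a node of $S_i(t)$ with the largest positive differential $Q_i(t)-Q_j(t)$ is selected, and $i$ keeps the packet if no differential is positive. **$f$-policy.** Let $f(m,n)>0$ for all integers $m\ge0$, $n\ge 1$, and assume that for all $m\ge0$ and $n_1,n_2>0$ $$\text{(C1)}\ \ \frac1{f(m,n_1+n_2)}=\frac1{f(m,n_1)}+\frac1{f(m+n_1,n_2)},\qquad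 \text{(C2)}\ \ f(m,n_1)\ge f(m+n_1,n_2).$$ Put $\Lambda_f(Q,R,n)=\sum_{i\le n}f(|C_1\cup\dots\cup C_{i-1}|,|C_i|)\sum_{a\in C_i}Q_a$. Call $R$ and $R'$ adjacent if one arises from the other by splitting one class into two consecutive ones, and let $m$ be the index of the first class in which they differ. Write $R<_QR'$ if $\Lambda_f(Q,R,m)<\Lambda_f(Q,R',m)$, or if these are equal and $R$ wins the tie. There are two tie rules: under the *finer* rule the finer of the two orderings wins, under the *coarser* rule the coarser one. Let $D_f(R)=\{Q\in\mathbb R^N_+: R<_QR'\text{ for all adjacent }R'\}$, and let $\pi_f(Q)=R$ mean that $D_f(R)$ is the one and only cone that contains $Q$. The $f$-policy is priority-based routing with $R(t)=\pi_f(Q(t))$. **Theorem.** 1. For every $f$ as above: * under the coarser rule $\pi_f(Q)$ is defined for every $Q\in\mathbb R^N_+$, and under the finer rule at least for every $Q\in\mathbb R^N_+$ with pairwise distinct entries; * under either rule, if $\pi_f(Q)=R$ and $j\prec^Rk$, then $Q_j<Q_k$; if only $Q\in D_f(R)$ and $j\prec^R k$, then still $Q_j\le Q_k$; * backpressure respects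 the $f$-policy: under backpressure, $R_b(t)$ is a refinement of $\pi_f(Q(t))$ for all $t$ under the coarser rule, and for all $t$ at which $\pi_f(Q(t))$ is defined under the finer rule. 2. Every DIVBAR policy is a backpressure policy for suitable orderings $R_b(t)$. 3. Backpressure is throughput optimal. -/

import Mathlib

open MeasureTheory ProbabilityTheory

/-! ### Rank orderings, cones and the map `π_f` -/

/-- A rank ordering `(C₁, …, C_M)` of the `N` non-destination nodes: an ordered list of non-empty,
pairwise disjoint ranking classes covering all of them. -/
structure RankOrdering (N : ℕ) where
  classes : List (Finset (Fin N))
  nonempty : ∀ C ∈ classes, C.Nonempty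
  disjoint : classes.Pairwise Disjoint
  cover : ∀ a : Fin N, ∃ C ∈ classes, a ∈ C

namespace RankOrdering

variable {N : ℕ}

/-- The ranking class with zero-based index `i` (empty beyond the end of the list). -/
def cls (R : RankOrdering N) (i : ℕ) : Finset (Fin N) := R.classes.getD i ∅

/-- The union of the first `i` ranking classes. -/
def below (R : RankOrdering N) (i : ℕ) : Finset (Fin N) := (Finset.range i).biUnion R.cls

/-- `a ≺^R b`. -/
def Lt (R : RankOrdering N) (a b : Fin N) : Prop := ∃ i j, i < j ∧ a ∈ R.cls i ∧ b ∈ R.cls j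

/-- `a ≼^R b`. -/
def Le (R : RankOrdering N) (a b : Fin N) : Prop := R.Lt a b ∨ ∃ i, a ∈ R.cls i ∧ b ∈ R.cls i

/-- `R'` is a refinement of `R`. -/
def Refines (R' R : RankOrdering N) : Prop := ∀ a b, R.Lt a b → R'.Lt a b

/-- `R'` arises from `R` by splitting one ranking class into two consecutive ones. -/
def OneStepRefinement (R' R : RankOrdering N) : Prop :=
  ∃ (L₁ L₂ : List (Finset (Fin N))) (A B : Finset (Fin N)),
    R.classes = L₁ ++ (A ∪ B) :: L₂ ∧ R'.classes = L₁ ++ A :: B :: L₂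

/-- One of the two orderings is a one-step refinement of the other. -/
def Adjacent (R R' : RankOrdering N) : Prop := OneStepRefinement R' R ∨ OneStepRefinement R R'

/-- The position, counted from one, of the first ranking class in which two different
orderings differ. -/
noncomputable def mismatch (R R' : RankOrdering N) : ℕ := sInf {i | R.cls i ≠ R'.cls i} + 1

end RankOrdering

/-- `Λ_f(Q, R, n)`: the sum of `f(|C^{i-1}|, |C_i|) Q_{C_i}` over the first `n` ranking classes. -/
noncomputable def penalty {N : ℕ} (f : ℕ → ℕ → ℝ) (Q : Fin N → ℝ) (R : RankOrdering N) (n : ℕ) :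
    ℝ :=
  ∑ i ∈ Finset.range n, f (R.below i).card (R.cls i).card * ∑ a ∈ R.cls i, Q a

/-- Which of two adjacent rank orderings wins when their penalties are equal. -/
inductive TieRule where
  | finer
  | coarser

/-- `R` wins a tie against `R'`. -/
def TieRule.Wins {N : ℕ} : TieRule → RankOrdering N → RankOrdering N → Prop
  | TieRule.finer, R, R' => RankOrdering.OneStepRefinement R R'
  | TieRule.coarser, R, R' => RankOrdering.OneStepRefinement R' R

/-- `R <_Q R'`: `R` penalizes `Q` less than `R'`. -/
def PenalizesLess {N : ℕ} (τ : TieRule) (f : ℕ → ℕ → ℝ) (Q : Fin N → ℝ) (R R' : RankOrdering N) :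
    Prop :=
  penalty f Q R (R.mismatch R') < penalty f Q R' (R.mismatch R') ∨
    (penalty f Q R (R.mismatch R') = penalty f Q R' (R.mismatch R') ∧ τ.Wins R R')

/-- The cone `D_f(R)`. -/
def cone {N : ℕ} (τ : TieRule) (f : ℕ → ℕ → ℝ) (R : RankOrdering N) : Set (Fin N → ℝ) :=
  {Q | (∀ a, 0 ≤ Q a) ∧ ∀ R', R.Adjacent R' → PenalizesLess τ f Q R R'}

/-- `π_f(Q) = R`: `D_f(R)` is the one cone that contains `Q`. -/
def IsPi {N : ℕ} (τ : TieRule) (f : ℕ → ℕ → ℝ) (Q : Fin N → ℝ) (R : RankOrdering N) : Prop :=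
  Q ∈ cone τ f R ∧ ∀ R', Q ∈ cone τ f R' → R' = R

/-- Condition (C1). -/
def CondC1 (f : ℕ → ℕ → ℝ) : Prop :=
  ∀ m n₁ n₂ : ℕ, 0 < n₁ → 0 < n₂ → 1 / f m (n₁ + n₂) = 1 / f m n₁ + 1 / f (m + n₁) n₂

/-- Condition (C2). -/
def CondC2 (f : ℕ → ℕ → ℝ) : Prop :=
  ∀ m n₁ n₂ : ℕ, 0 < n₁ → 0 < n₂ → f (m + n₁) n₂ ≤ f m n₁

/-! ### The network -/

/-- The nodes: `none` is the destination (node `0`), `some a` are the other `N` nodes. -/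
abbrev Node (N : ℕ) : Type := Option (Fin N)

/-- `j ≼^R k` on all nodes, where the destination has the lowest rank. -/
def RankOrdering.NodeLe {N : ℕ} (R : RankOrdering N) : Node N → Node N → Prop
  | none, _ => True
  | some _, none => False
  | some a, some b => R.Le a b

/-- The local broadcast model: `prob i S` is the probability `P(S | i)` that `S` is the set of nodes
that have the packet after a transmission by `i`; the transmitter itself always has it. -/
structure Network (N : ℕ) where
  prob : Node N → Finset (Node N) → ℝ
  prob_nonneg : ∀ i S, 0 ≤ prob i S
  prob_sum : ∀ i, ∑ S : Finset (Node N), prob i S = 1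
  prob_self : ∀ i S, prob i S ≠ 0 → i ∈ S

/-- The exogenous randomness with arrival rate vector `lam`, on a probability space `(Ω, P)`:
initial backlogs `Q₀`, bounded arrivals `A t`, and the sets `S t i` of potential forwarders. -/
structure Scenario {N : ℕ} (net : Network N) (lam : Fin N → ℝ) {Ω : Type} [MeasurableSpace Ω]
    (P : Measure Ω) where
  Q₀ : Ω → Fin N → ℝ
  A : ℕ → Ω → Fin N → ℝ
  S : ℕ → Ω → Node N → Finset (Node N)
  measurable_Q₀ : Measurable Q₀
  measurable_A : ∀ t, Measurable (A t)
  measurable_S : ∀ t, Measurable (S t)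
  Q₀_nonneg : ∀ ω a, 0 ≤ Q₀ ω a
  Q₀_sq : ∀ a, MemLp (fun ω => Q₀ ω a) 2 P
  A_nonneg : ∀ t ω a, 0 ≤ A t ω a
  A_bdd : ∃ Amax : ℝ, ∀ t ω a, A t ω a ≤ Amax
  A_ident : ∀ t, IdentDistrib (A t) (A 0) P P
  A_mean : ∀ a, ∫ ω, A 0 ω a ∂P = lam a
  S_self : ∀ t ω i, i ∈ S t ω i
  S_law : ∀ t i s, P.real {ω | S t ω i = s} = net.prob i s
  indep_time : iIndepFun (fun t ω => (A t ω, S t ω)) P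
  indep_init : IndepFun Q₀ (fun ω t => (A t ω, S t ω)) P

/-- A family of routing decisions: `μ t ω i j` is the number of packets whose relaying
responsibility is shifted from `i` to `j` in slot `t`. -/
abbrev Decisions (N : ℕ) (Ω : Type) : Type := ℕ → Ω → Node N → Node N → ℕ

namespace Scenario

variable {N : ℕ} {net : Network N} {lam : Fin N → ℝ} {Ω : Type} [MeasurableSpace Ω]
  {P : Measure Ω}

/-- The queue backlogs `Q_i(t)`; the backlog of the destination is always zero. -/
noncomputable def backlog (X : Scenario net lam P) (μ : Decisions N Ω) : ℕ → Ω → Node N → ℝ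
  | _, _, none => 0
  | 0, ω, some a => X.Q₀ ω a
  | t + 1, ω, some a =>
      max (X.backlog μ t ω (some a) - ∑ j, (μ t ω (some a) j : ℝ)) 0
        + ∑ j, (μ t ω j (some a) : ℝ) *
            (if (μ t ω j (some a) : ℝ) ≤ X.backlog μ t ω j then 1 else 0)
        + X.A t ω a

/-- The vector `(Q_1(t), …, Q_N(t))`. -/
noncomputable def Q (X : Scenario net lam P) (μ : Decisions N Ω) (t : ℕ) (ω : Ω) : Fin N → ℝ :=
  fun a => X.backlog μ t ω (some a)

/-- The σ-field generated by `Q_i(s), S_i(s)` for `s ≤ t` and `μ_ij(s)` for `s < t`. -/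
@[reducible] noncomputable def history (X : Scenario net lam P) (μ : Decisions N Ω) (t : ℕ) : MeasurableSpace Ω :=
  (⨆ s ∈ Set.Iic t, ⨆ i : Node N,
      MeasurableSpace.comap (fun ω => X.backlog μ s ω i) inferInstance
        ⊔ MeasurableSpace.comap (fun ω => X.S s ω i) inferInstance)
    ⊔ ⨆ s ∈ Set.Iio t, ⨆ i : Node N, ⨆ j : Node N,
        MeasurableSpace.comap (fun ω => μ s ω i j) inferInstance

/-- A routing policy: feasible, non-anticipating routing decisions. A packet received by the
destination is handed over to it. -/
structure IsRoutingPolicy (X : Scenario net lam P) (μ : Decisions N Ω) : Prop where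
  le_indicator : ∀ t ω i j, μ t ω i j ≤ if j ∈ X.S t ω i then 1 else 0
  sum_le_one : ∀ t ω i, ∑ j, μ t ω i j ≤ 1
  deliver : ∀ t ω i, none ∈ X.S t ω i → μ t ω i none = 1
  adapted : ∀ t i j θ, MeasurableSet[X.history μ t] {ω | μ t ω i j = θ}

/-- The policy stabilizes the network: the time average expected backlog of every node is finite. -/
def Stabilizes (X : Scenario net lam P) (μ : Decisions N Ω) : Prop :=
  ∀ a : Fin N, Filter.limsup
    (fun T : ℕ => (∑ t ∈ Finset.range T, ∫⁻ ω, ENNReal.ofReal (X.Q μ t ω a) ∂P) / (T : ENNReal))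
    Filter.atTop < ⊤

/-- The priority-based routing policy with rank orderings `R t`: among its potential forwarders,
each node selects one with the lowest rank. -/
structure IsPriorityBased (X : Scenario net lam P) (μ : Decisions N Ω)
    (R : ℕ → Ω → RankOrdering N) : Prop where
  policy : X.IsRoutingPolicy μ
  selects : ∀ t ω i, ∃ j, μ t ω i j = 1
  lowest : ∀ t ω i j, μ t ω i j = 1 → j ∈ X.S t ω i ∧ ∀ k ∈ X.S t ω i, (R t ω).NodeLe j k

/-- Backpressure: priority-based routing with rank orderings in which a smaller backlog means a
lower rank. Nodes with equal backlogs may share a class or be ordered arbitrarily. -/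
structure IsBackpressure (X : Scenario net lam P) (μ : Decisions N Ω)
    (R : ℕ → Ω → RankOrdering N) : Prop where
  priority : X.IsPriorityBased μ R
  smaller_lower : ∀ t ω a b, X.Q μ t ω a < X.Q μ t ω b → (R t ω).Lt a b

/-- DIVBAR: a packet received by the destination is delivered; otherwise a potential forwarder with
the largest positive differential backlog takes the packet, and if there is none, the transmitter
keeps it. -/
structure IsDIVBAR (X : Scenario net lam P) (μ : Decisions N Ω) : Prop where
  policy : X.IsRoutingPolicy μ
  forward : ∀ t ω i, none ∉ X.S t ω i →
    (∃ j ∈ X.S t ω i, 0 < X.backlog μ t ω i - X.backlog μ t ω j) →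
    ∃ j ∈ X.S t ω i, μ t ω i j = 1 ∧ ∀ k ∈ X.S t ω i,
      X.backlog μ t ω i - X.backlog μ t ω k ≤ X.backlog μ t ω i - X.backlog μ t ω j
  retain : ∀ t ω i, none ∉ X.S t ω i →
    (∀ j ∈ X.S t ω i, X.backlog μ t ω i - X.backlog μ t ω j ≤ 0) → μ t ω i i = 1

end Scenario

/-- The policy with rank orderings `R'` respects the one with rank orderings `R`. -/
def Respects {N : ℕ} {Ω : Type} (R' R : ℕ → Ω → RankOrdering N) : Prop :=
  ∀ t ω, (R' t ω).Refines (R t ω)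

/-- The stability region: the arrival rate vectors for which, whatever the arrival process with that
rate, some routing policy stabilizes the network. -/
def stabilityRegion {N : ℕ} (net : Network N) : Set (Fin N → ℝ) :=
  {lam | (∀ a, 0 ≤ lam a) ∧
    ∀ (Ω : Type) [MeasurableSpace Ω] (P : Measure Ω) [IsProbabilityMeasure P]
      (X : Scenario net lam P), ∃ μ : Decisions N Ω, X.IsRoutingPolicy μ ∧ X.Stabilizes μ}

/-- Backpressure is throughput optimal: it stabilizes the network for every arrival rate vector in
the interior of the stability region. -/
def BackpressureThroughputOptimal {N : ℕ} (net : Network N) : Prop :=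
  ∀ lam ∈ interior (stabilityRegion net),
    ∀ (Ω : Type) [MeasurableSpace Ω] (P : Measure Ω) [IsProbabilityMeasure P]
      (X : Scenario net lam P) (μ : Decisions N Ω) (R : ℕ → Ω → RankOrdering N),
      X.IsBackpressure μ R → X.Stabilizes μ

/-! **Orderings.** By (C1), $1/f(m,n)$ is an additive length: it is the sum of $1/f(k,1)$ over the
positions $m\le k<m+n$. The term that a class contributes to $\Lambda_f$ is therefore its total
backlog divided by its length, a density. Two adjacent orderings share all terms before the class
that is split, so comparing them means comparing the density of a first part $A$ with that of $A\cup
B$. The latter is a mediant, so this amounts to comparing $A$ with $B$. Hence $Q\in D_f(R)$ says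
that the classes of $R$ form a kind of lower convex hull: densities increase from class to class and
no class should be split (`mem_cone_iff`). A hull always exists: repeatedly remove a subset of
minimal density, the largest one under the coarser rule and the smallest under the finer rule
(`exists_isHull`). By (C2) the length of a position does not decrease along the order, so increasing
densities force increasing backlogs across classes (`IsHull.pairwise`). If the backlogs increase
strictly across classes, each initial union of classes is a lower set for $Q$, and two such hulls
agree (`IsHull.unique`). Strictness is automatic under the coarser rule and for distinct entries.
Under the finer rule, uniqueness of the cone itself yields strictness: swapping two equal backlogs
in different classes would produce a second cone. Respect is then immediate, because backpressure
ranks smaller backlogs lower. **DIVBAR.** A largest differential is a smallest backlog, so ordering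
nodes by the level sets of $Q$ exhibits DIVBAR as backpressure. **Throughput.** If stationary
randomized routing leaves spare capacity $\delta>0$ at every node, the drift of $\sum_a Q_a^2$ under
backpressure is at most a constant minus $2\delta\sum_a\mathbb E\,Q_a$: backpressure minimizes the
relevant bound slot by slot, and current backlogs are independent of the current slot's randomness.
Telescoping gives stability (`IsBackpressure.stabilizes`). Such a routing exists for interior
$\lambda$. Raise all rates slightly and apply the definition of the region to integer arrivals and
empty queues, where the dynamics conserve packets. A stabilizing policy has total mean backlog at
most a small multiple of $T$ at some time $T>0$; averaging its flows up to $T$ gives stationary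
routing whose deficit is smaller than the increase in rates
(`exists_stationaryRouting_of_mem_interior`). A single finite horizon suffices, so no limit of flows
is taken. -/

/-! ### Hulls: lists of classes with increasing densities -/

/-- The comparison of densities under which the finer of two adjacent orderings is preferred. -/
def TieRule.FLt : TieRule → ℝ → ℝ → Prop
  | TieRule.finer, x, y => x ≤ y
  | TieRule.coarser, x, y => x < y

namespace TieRule

theorem FLt.le {τ : TieRule} {x y : ℝ} (h : τ.FLt x y) : x ≤ y := by
  cases τ
  · exact h
  · exact _root_.le_of_lt h

theorem le_of_not_FLt {τ : TieRule} {x y : ℝ} (h : ¬ τ.FLt x y) : y ≤ x := by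
  cases τ
  · exact (not_le.1 h).le
  · exact not_lt.1 h

theorem FLt.trans_le {τ : TieRule} {x y z : ℝ} (h : τ.FLt x y) (h' : y ≤ z) : τ.FLt x z := by
  cases τ
  · exact le_trans h h'
  · exact lt_of_lt_of_le h h'

theorem FLt.trans_ge {τ : TieRule} {x y z : ℝ} (h' : x ≤ y) (h : τ.FLt y z) : τ.FLt x z := by
  cases τ
  · exact le_trans h' h
  · exact lt_of_le_of_lt h' h

theorem FLt.mul_iff {τ : TieRule} {c x y : ℝ} (hc : 0 < c) :
    τ.FLt (c * x) (c * y) ↔ τ.FLt x y := by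
  cases τ
  · exact mul_le_mul_iff_right₀ hc
  · exact mul_lt_mul_iff_right₀ hc

theorem FLt.mediant {τ : TieRule} {x y u v : ℝ} (hu : 0 < u) (hv : 0 < v) :
    τ.FLt (x / u) ((x + y) / (u + v)) ↔ τ.FLt (x / u) (y / v) := by
  cases τ
  · simp only [FLt]
    rw [div_le_div_iff₀ hu (by positivity), div_le_div_iff₀ hu hv]
    constructor <;> intro h <;> linarith
  · simp only [FLt]
    rw [div_lt_div_iff₀ hu (by positivity), div_lt_div_iff₀ hu hv]
    constructor <;> intro h <;> linarith

end TieRule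

section Hull

variable {N : ℕ}

/-- The term contributed to the penalty by a class `C` that is preceded by `m` nodes. -/
noncomputable def density (f : ℕ → ℕ → ℝ) (Q : Fin N → ℝ) (m : ℕ) (C : Finset (Fin N)) : ℝ :=
  f m C.card * ∑ a ∈ C, Q a

/-- No class of the list is worth splitting and no two consecutive classes are worth merging;
the list is preceded by `m` nodes. -/
def IsHull (τ : TieRule) (f : ℕ → ℕ → ℝ) (Q : Fin N → ℝ) : ℕ → List (Finset (Fin N)) → Prop
  | _, [] => True
  | m, C :: l =>
    (∀ A B : Finset (Fin N), A.Nonempty → B.Nonempty → Disjoint A B → A ∪ B = C →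
      ¬ τ.FLt (density f Q m A) (density f Q m C)) ∧
    (∀ D l', l = D :: l' → τ.FLt (density f Q m C) (density f Q m (C ∪ D))) ∧
    IsHull τ f Q (m + C.card) l

variable {f : ℕ → ℕ → ℝ} {Q : Fin N → ℝ} {τ : TieRule}

/-- Under (C1) both backlogs and the lengths `1 / f` add up, so the density of a union is the
mediant of the densities of its parts. All later comparisons rest on this. -/
theorem density_union_eq (h1 : CondC1 f) (m : ℕ) {A B : Finset (Fin N)} (hA : A.Nonempty)
    (hB : B.Nonempty) (hd : Disjoint A B) :
    density f Q m (A ∪ B) = (∑ a ∈ A, Q a + ∑ a ∈ B, Q a) /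
      (1 / f m A.card + 1 / f (m + A.card) B.card) := by
  rw [← h1 m _ _ hA.card_pos hB.card_pos, density, Finset.card_union_of_disjoint hd,
    Finset.sum_union hd, div_div_eq_mul_div, div_one, mul_comm]

theorem density_eq_div (m : ℕ) (A : Finset (Fin N)) :
    density f Q m A = (∑ a ∈ A, Q a) / (1 / f m A.card) := by
  rw [div_div_eq_mul_div, div_one, mul_comm, density]

theorem FLt_density_union_iff (h0 : ∀ m n, 0 < n → 0 < f m n) (h1 : CondC1 f) (m : ℕ)
    {A B : Finset (Fin N)} (hA : A.Nonempty) (hB : B.Nonempty) (hd : Disjoint A B) :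
    τ.FLt (density f Q m A) (density f Q m (A ∪ B)) ↔
      τ.FLt (density f Q m A) (density f Q (m + A.card) B) := by
  rw [density_union_eq h1 m hA hB hd, density_eq_div, density_eq_div]
  exact TieRule.FLt.mediant (one_div_pos.2 (h0 _ _ hA.card_pos))
    (one_div_pos.2 (h0 _ _ hB.card_pos))

theorem le_density_union (h0 : ∀ m n, 0 < n → 0 < f m n) (h1 : CondC1 f) (m : ℕ)
    {A B : Finset (Fin N)} (hA : A.Nonempty) (hB : B.Nonempty) (hd : Disjoint A B) {x : ℝ}
    (hxA : x ≤ density f Q m A) (hxB : x ≤ density f Q (m + A.card) B) :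
    x ≤ density f Q m (A ∪ B) := by
  have hu := one_div_pos.2 (h0 m _ hA.card_pos)
  have hv := one_div_pos.2 (h0 (m + A.card) _ hB.card_pos)
  rw [density_union_eq h1 m hA hB hd, le_div_iff₀ (by positivity)]
  rw [density_eq_div, le_div_iff₀ hu] at hxA
  rw [density_eq_div, le_div_iff₀ hv] at hxB
  linarith

theorem density_right_le (h0 : ∀ m n, 0 < n → 0 < f m n) (h1 : CondC1 f) (m : ℕ)
    {A B : Finset (Fin N)} (hA : A.Nonempty) (hB : B.Nonempty) (hd : Disjoint A B)
    (h : density f Q m (A ∪ B) ≤ density f Q m A) :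
    density f Q (m + A.card) B ≤ density f Q m (A ∪ B) := by
  have hu := one_div_pos.2 (h0 m _ hA.card_pos)
  have hv := one_div_pos.2 (h0 (m + A.card) _ hB.card_pos)
  have huv : 0 < 1 / f m A.card + 1 / f (m + A.card) B.card := by positivity
  rw [density_eq_div m A, le_div_iff₀ hu] at h
  rw [density_eq_div (m + A.card) B, div_le_iff₀ hv]
  have h2 : density f Q m (A ∪ B) * (1 / f m A.card + 1 / f (m + A.card) B.card)
      = ∑ a ∈ A, Q a + ∑ a ∈ B, Q a := by
    rw [density_union_eq h1 m hA hB hd, div_mul_cancel₀ _ huv.ne']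
  linarith

theorem density_singleton (m : ℕ) (a : Fin N) : density f Q m {a} = f m 1 * Q a := by
  simp [density]

/-- In a class that is not worth splitting, the last node has at most the density of the class. -/
theorem last_le_density (h0 : ∀ m n, 0 < n → 0 < f m n) (h1 : CondC1 f) {m : ℕ}
    {C : Finset (Fin N)}
    (hC : ∀ A B : Finset (Fin N), A.Nonempty → B.Nonempty → Disjoint A B → A ∪ B = C →
      ¬ τ.FLt (density f Q m A) (density f Q m C)) {j : Fin N} (hj : j ∈ C) :
    f (m + C.card - 1) 1 * Q j ≤ density f Q m C := by
  rcases (C.erase j).eq_empty_or_nonempty with h | h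
  · have hCj : C = {j} := by
      rw [← Finset.insert_erase hj, h]; rfl
    subst hCj
    simp [density]
  · have hd : Disjoint (C.erase j) {j} := by simp
    have hu : C.erase j ∪ {j} = C := by
      rw [Finset.union_comm, ← Finset.insert_eq, Finset.insert_erase hj]
    have h3 : density f Q m (C.erase j ∪ {j}) ≤ density f Q m (C.erase j) := by
      rw [hu]
      exact TieRule.le_of_not_FLt (hC _ _ h (Finset.singleton_nonempty j) hd hu)
    have h4 := density_right_le h0 h1 m h (Finset.singleton_nonempty j) hd h3
    rw [hu, density_singleton] at h4
    have : m + (C.erase j).card = m + C.card - 1 := by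
      have := Finset.card_erase_add_one hj
      omega
    rwa [this] at h4

/-- In a class that is not worth splitting, the first node has at least the density of the class. -/
theorem density_le_first {m : ℕ} {C : Finset (Fin N)}
    (hC : ∀ A B : Finset (Fin N), A.Nonempty → B.Nonempty → Disjoint A B → A ∪ B = C →
      ¬ τ.FLt (density f Q m A) (density f Q m C)) {j : Fin N} (hj : j ∈ C) :
    density f Q m C ≤ f m 1 * Q j := by
  rw [← density_singleton]
  rcases (C.erase j).eq_empty_or_nonempty with h | h
  · have hCj : C = {j} := by
      rw [← Finset.insert_erase hj, h]; rfl
    rw [hCj]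
  · exact TieRule.le_of_not_FLt (hC {j} _ (Finset.singleton_nonempty j) h (by simp)
      (by rw [← Finset.insert_eq, Finset.insert_erase hj]))

/-- Later classes of a hull have larger backlogs. -/
theorem IsHull.pairwise (h0 : ∀ m n, 0 < n → 0 < f m n) (h1 : CondC1 f) (h2 : CondC2 f)
    (hQ : ∀ a, 0 ≤ Q a) : ∀ {l : List (Finset (Fin N))} {m : ℕ}, (∀ C ∈ l, C.Nonempty) →
    l.Pairwise Disjoint → IsHull τ f Q m l →
    l.Pairwise fun C D => ∀ j ∈ C, ∀ k ∈ D, τ.FLt (Q j) (Q k)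
  | [], _, _, _, _ => List.Pairwise.nil
  | C :: l, m, hne, hdis, ⟨hsplit, hmerge, htail⟩ => by
    have ih := IsHull.pairwise h0 h1 h2 hQ (fun D hD => hne D (List.mem_cons_of_mem _ hD))
      (List.pairwise_cons.1 hdis).2 htail
    refine List.pairwise_cons.2 ⟨?_, ih⟩
    cases l with
    | nil => simp
    | cons D l =>
      have hCne := hne C (by simp)
      have hDne := hne D (by simp)
      have hCD : Disjoint C D := (List.pairwise_cons.1 hdis).1 D (by simp)
      -- Place `j` last in `C` and `k` first in `D`, next to each other. The densities of `C` and
      -- `D` then lie between `f (m + C.card - 1) 1 * Q j` and `f (m + C.card) 1 * Q k`; (C2)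
      -- replaces the second factor by the first, which cancels.
      have key : ∀ j ∈ C, ∀ k ∈ D, τ.FLt (Q j) (Q k) := by
        intro j hj k hk
        have e1 := last_le_density h0 h1 hsplit hj
        have e2 := (FLt_density_union_iff h0 h1 m hCne hDne hCD).1 (hmerge D l rfl)
        have e3 := density_le_first htail.1 hk
        have e4 := TieRule.FLt.trans_ge e1 (e2.trans_le e3)
        have hc := hCne.card_pos
        have e5 : f (m + C.card) 1 ≤ f (m + C.card - 1) 1 := by
          have := h2 (m + C.card - 1) 1 1 one_pos one_pos
          rwa [show m + C.card - 1 + 1 = m + C.card by omega] at this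
        exact (TieRule.FLt.mul_iff (h0 _ 1 one_pos)).1
          (e4.trans_le (mul_le_mul_of_nonneg_right e5 (hQ k)))
      intro E hE
      rcases List.mem_cons.1 hE with rfl | hE
      · exact key
      · intro j hj k hk
        obtain ⟨d, hd⟩ := hDne
        exact (key j hj d hd).trans_le (((List.pairwise_cons.1 ih).1 E hE d hd k hk).le)

/-- A lower set of a hull has at least the density of the first class. -/
theorem IsHull.le_density (h0 : ∀ m n, 0 < n → 0 < f m n) (h1 : CondC1 f) {x : ℝ} :
    ∀ {l : List (Finset (Fin N))} {m : ℕ} {T : Finset (Fin N)}, (∀ C ∈ l, C.Nonempty) →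
    (l.Pairwise fun C D => ∀ j ∈ C, ∀ k ∈ D, Q j < Q k) → IsHull τ f Q m l → T.Nonempty →
    (∀ a ∈ T, ∃ C ∈ l, a ∈ C) → (∀ C ∈ l, ∀ a ∈ T, ∀ b ∈ C, b ∉ T → Q a < Q b) →
    (∀ C l', l = C :: l' → x ≤ density f Q m C) → x ≤ density f Q m T
  | [], m, T, _, _, _, ⟨a, ha⟩, hcov, _, _ => by simpa using hcov a ha
  | C :: l, m, T, hne, hsep, ⟨hsplit, hmerge, htail⟩, hT, hcov, hlow, hx => by
    have hxC := hx C l rfl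
    have hCne := hne C (by simp)
    rw [List.pairwise_cons] at hsep
    -- Either `T` is an initial part of `C`, and `C` is not worth splitting, or the lower set `T`
    -- contains all of `C`. In the latter case induction applies to `T \ C`, and a mediant of
    -- numbers that are at least `x` is at least `x`.
    by_cases hTC : T ⊆ C
    · rcases (C \ T).eq_empty_or_nonempty with h | h
      · rwa [hTC.antisymm (Finset.sdiff_eq_empty_iff_subset.1 h)]
      · exact hxC.trans (TieRule.le_of_not_FLt (hsplit T (C \ T) hT h Finset.disjoint_sdiff
          (Finset.union_sdiff_of_subset hTC)))
    · obtain ⟨a, haT, haC⟩ := Finset.not_subset.1 hTC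
      have hCT : C ⊆ T := by
        intro b hb
        by_contra hbT
        obtain ⟨D, hD, haD⟩ := hcov a haT
        rcases List.mem_cons.1 hD with rfl | hD
        · exact haC haD
        · exact lt_asymm (hlow C (by simp) a haT b hb hbT) (hsep.1 D hD b hb a haD)
      have hne' : (T \ C).Nonempty := ⟨a, by simp [haT, haC]⟩
      have := IsHull.le_density (l := l) (T := T \ C) h0 h1
        (fun D hD => hne D (List.mem_cons_of_mem _ hD)) hsep.2 htail hne'
        (fun a ha => by
          rw [Finset.mem_sdiff] at ha
          obtain ⟨D, hD, haD⟩ := hcov a ha.1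
          rcases List.mem_cons.1 hD with rfl | hD
          · exact absurd haD ha.2
          · exact ⟨D, hD, haD⟩)
        (fun D hD a ha b hb hbT => by
          rw [Finset.mem_sdiff] at ha hbT
          by_cases hbT' : b ∈ T
          · have hbC : b ∈ C := by
              by_contra hbC
              exact hbT ⟨hbT', hbC⟩
            exact absurd (hsep.1 D hD b hbC b hb) (lt_irrefl _)
          · exact hlow D (List.mem_cons_of_mem _ hD) a ha.1 b hb hbT')
        (fun D l' hl => by
          have hDne := hne D (by simp [hl])
          have hCD : Disjoint C D := by
            rw [Finset.disjoint_left]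
            intro b hb hb'
            exact lt_irrefl _ (hsep.1 D (by simp [hl]) b hb b hb')
          exact hxC.trans
            ((FLt_density_union_iff h0 h1 m hCne hDne hCD).1 (hmerge D l' hl)).le)
      have hfin := le_density_union h0 h1 m hCne hne' Finset.disjoint_sdiff hxC this
      rwa [Finset.union_sdiff_of_subset hCT] at hfin

/-- The first class of a hull is not strictly contained in the first class of another one. -/
theorem IsHull.not_ssubset (h0 : ∀ m n, 0 < n → 0 < f m n) (h1 : CondC1 f)
    {C C' : Finset (Fin N)} {l l' : List (Finset (Fin N))} {m : ℕ}
    (hne : ∀ D ∈ C :: l, D.Nonempty)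
    (hsep : (C :: l).Pairwise fun C D => ∀ j ∈ C, ∀ k ∈ D, Q j < Q k)
    (hsep' : (C' :: l').Pairwise fun C D => ∀ j ∈ C, ∀ k ∈ D, Q j < Q k)
    (hcov : ∀ a, (∃ D ∈ C :: l, a ∈ D) ↔ ∃ D ∈ C' :: l', a ∈ D)
    (hh : IsHull τ f Q m (C :: l)) (hh' : IsHull τ f Q m (C' :: l')) (hCC : C ⊆ C') : C = C' := by
  by_contra hCne
  have hne' : (C' \ C).Nonempty := by
    rw [Finset.nonempty_iff_ne_empty]
    intro h
    exact hCne (hCC.antisymm (Finset.sdiff_eq_empty_iff_subset.1 h))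
  rw [List.pairwise_cons] at hsep hsep'
  have hCnon := hne C (by simp)
  have hcov1 : ∀ a ∈ C' \ C, ∃ D ∈ l, a ∈ D := by
    intro a ha
    rw [Finset.mem_sdiff] at ha
    obtain ⟨D, hD, haD⟩ := (hcov a).2 ⟨C', by simp, ha.1⟩
    rcases List.mem_cons.1 hD with rfl | hD
    · exact absurd haD ha.2
    · exact ⟨D, hD, haD⟩
  cases l with
  | nil =>
    obtain ⟨a, ha⟩ := hne'
    simpa using hcov1 a ha
  | cons D l =>
    have hDne := hne D (by simp)
    have hCD : Disjoint C D := by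
      rw [Finset.disjoint_left]
      intro b hb hb'
      exact lt_irrefl _ (hsep.1 D (by simp) b hb b hb')
    have e1 := (FLt_density_union_iff h0 h1 m hCnon hDne hCD).1 (hh.2.1 D l rfl)
    -- `C' \ C` is a lower set of the hull that remains after `C`, so it is at least as dense as its
    -- first class `D`. Hence splitting `C` off `C'` is as worthwhile as keeping `C` apart from `D`,
    -- a contradiction.
    have e2 : density f Q (m + C.card) D ≤ density f Q (m + C.card) (C' \ C) := by
      refine IsHull.le_density h0 h1 (fun E hE => hne E (List.mem_cons_of_mem _ hE)) hsep.2
        hh.2.2 hne' hcov1 ?_ ?_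
      · intro E hE a ha b hb hbT
        rw [Finset.mem_sdiff] at ha hbT
        have hbC : b ∉ C := fun hbC => lt_irrefl _ (hsep.1 E hE b hbC b hb)
        have hbC' : b ∉ C' := fun h => hbT ⟨h, hbC⟩
        obtain ⟨F, hF, hbF⟩ := (hcov b).1 ⟨E, List.mem_cons_of_mem _ hE, hb⟩
        rcases List.mem_cons.1 hF with rfl | hF
        · exact absurd hbF hbC'
        · exact hsep'.1 F hF a ha.1 b hbF
      · rintro E l' h
        simp only [List.cons.injEq] at h
        rw [h.1]
    have e3 := (FLt_density_union_iff h0 h1 m hCnon hne' Finset.disjoint_sdiff).2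
      (e1.trans_le e2)
    rw [Finset.union_sdiff_of_subset hCC] at e3
    exact hh'.1 C (C' \ C) hCnon hne' Finset.disjoint_sdiff
      (Finset.union_sdiff_of_subset hCC) e3

/-- Strictly separated hulls with the same nodes agree. -/
theorem IsHull.unique (h0 : ∀ m n, 0 < n → 0 < f m n) (h1 : CondC1 f) :
    ∀ {l l' : List (Finset (Fin N))} {m : ℕ}, (∀ D ∈ l, D.Nonempty) → (∀ D ∈ l', D.Nonempty) →
    (l.Pairwise fun C D => ∀ j ∈ C, ∀ k ∈ D, Q j < Q k) →
    (l'.Pairwise fun C D => ∀ j ∈ C, ∀ k ∈ D, Q j < Q k) →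
    (∀ a, (∃ D ∈ l, a ∈ D) ↔ ∃ D ∈ l', a ∈ D) →
    IsHull τ f Q m l → IsHull τ f Q m l' → l = l'
  | [], [], _, _, _, _, _, _, _, _ => rfl
  | [], C' :: l', _, _, hne', _, _, hcov, _, _ => by
    obtain ⟨a, ha⟩ := hne' C' (by simp)
    simpa using (hcov a).2 ⟨C', by simp, ha⟩
  | C :: l, [], _, hne, _, _, _, hcov, _, _ => by
    obtain ⟨a, ha⟩ := hne C (by simp)
    simpa using (hcov a).1 ⟨C, by simp, ha⟩
  | C :: l, C' :: l', m, hne, hne', hsep, hsep', hcov, hh, hh' => by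
    -- Both first classes are lower sets for `Q`, and lower sets are nested.
    have hor : C ⊆ C' ∨ C' ⊆ C := by
      by_contra hcon
      rw [not_or, Finset.not_subset, Finset.not_subset] at hcon
      obtain ⟨⟨a, ha, ha'⟩, b, hb', hb⟩ := hcon
      obtain ⟨D, hD, haD⟩ := (hcov a).1 ⟨C, by simp, ha⟩
      obtain ⟨E, hE, hbE⟩ := (hcov b).2 ⟨C', by simp, hb'⟩
      rcases List.mem_cons.1 hD with rfl | hD
      · exact ha' haD
      rcases List.mem_cons.1 hE with rfl | hE
      · exact hb hbE
      exact lt_asymm ((List.pairwise_cons.1 hsep).1 E hE a ha b hbE)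
        ((List.pairwise_cons.1 hsep').1 D hD b hb' a haD)
    have hCC : C = C' := by
      rcases hor with h | h
      · exact IsHull.not_ssubset h0 h1 hne hsep hsep' hcov hh hh' h
      · exact (IsHull.not_ssubset h0 h1 hne' hsep' hsep (fun a => (hcov a).symm) hh' hh h).symm
    subst hCC
    rw [List.pairwise_cons] at hsep hsep'
    congr 1
    refine IsHull.unique h0 h1 (fun D hD => hne D (List.mem_cons_of_mem _ hD))
      (fun D hD => hne' D (List.mem_cons_of_mem _ hD)) hsep.2 hsep'.2 ?_ hh.2.2 hh'.2.2
    intro a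
    constructor
    · rintro ⟨D, hD, haD⟩
      obtain ⟨E, hE, haE⟩ := (hcov a).1 ⟨D, List.mem_cons_of_mem _ hD, haD⟩
      rcases List.mem_cons.1 hE with rfl | hE
      · exact absurd (hsep.1 D hD a haE a haD) (lt_irrefl _)
      · exact ⟨E, hE, haE⟩
    · rintro ⟨D, hD, haD⟩
      obtain ⟨E, hE, haE⟩ := (hcov a).2 ⟨D, List.mem_cons_of_mem _ hD, haD⟩
      rcases List.mem_cons.1 hE with rfl | hE
      · exact absurd (hsep'.1 D hD a haE a haD) (lt_irrefl _)
      · exact ⟨E, hE, haE⟩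

/-- An extremal class: the largest minimizer of the density under the coarser rule, the smallest
one under the finer rule. -/
theorem exists_extremal_class (τ : TieRule) (f : ℕ → ℕ → ℝ) (Q : Fin N → ℝ) (m : ℕ)
    {U : Finset (Fin N)} (hU : U.Nonempty) :
    ∃ C ⊆ U, C.Nonempty ∧
      (∀ S ⊆ U, C.card < S.card → τ.FLt (density f Q m C) (density f Q m S)) ∧
      ∀ S ⊆ U, S.Nonempty → S.card < C.card → ¬ τ.FLt (density f Q m S) (density f Q m C) := by
  classical
  obtain ⟨C₀, hC₀, hmin⟩ := Finset.exists_min_image (U.powerset.filter Finset.Nonempty)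
    (density f Q m) ⟨U, by simp [hU]⟩
  simp only [Finset.mem_filter, Finset.mem_powerset, and_imp] at hC₀ hmin
  let F := U.powerset.filter fun C => C.Nonempty ∧ density f Q m C = density f Q m C₀
  have hF : F.Nonempty := ⟨C₀, by simp [F, hC₀]⟩
  cases τ with
  | finer =>
    obtain ⟨C, hC, hcard⟩ := Finset.exists_min_image F Finset.card hF
    simp only [F, Finset.mem_filter, Finset.mem_powerset, and_imp] at hC hcard
    refine ⟨C, hC.1, hC.2.1, fun S hS hlt => ?_, fun S hS hSne hlt => ?_⟩
    · exact hC.2.2.le.trans (hmin S hS (Finset.card_pos.1 (by omega)))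
    · intro h
      have := hcard S hS hSne ((h.trans hC.2.2.le).antisymm (hmin S hS hSne))
      omega
  | coarser =>
    obtain ⟨C, hC, hcard⟩ := Finset.exists_max_image F Finset.card hF
    simp only [F, Finset.mem_filter, Finset.mem_powerset, and_imp] at hC hcard
    refine ⟨C, hC.1, hC.2.1, fun S hS hlt => ?_, fun S hS hSne hlt => ?_⟩
    · have hSne : S.Nonempty := Finset.card_pos.1 (by omega)
      refine lt_of_le_of_ne (hC.2.2.le.trans (hmin S hS hSne)) fun h => ?_
      have := hcard S hS hSne (h.symm.trans hC.2.2)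
      omega
    · exact not_lt.2 (hC.2.2.le.trans (hmin S hS hSne))

/-- Greedy construction: an extremal class comes first, then a hull of the remaining nodes.
Splitting or merging it would compare it with a smaller or larger subset of the same set, which
extremality rules out. No condition on `f` enters. -/
theorem exists_isHull (τ : TieRule) (f : ℕ → ℕ → ℝ) (Q : Fin N → ℝ) (U : Finset (Fin N)) :
    ∀ m : ℕ, ∃ l : List (Finset (Fin N)), (∀ C ∈ l, C.Nonempty) ∧ l.Pairwise Disjoint ∧
      (∀ C ∈ l, C ⊆ U) ∧ (∀ a ∈ U, ∃ C ∈ l, a ∈ C) ∧ IsHull τ f Q m l := by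
  classical
  induction U using Finset.strongInduction with
  | H U ih =>
    intro m
    rcases U.eq_empty_or_nonempty with rfl | hU
    · exact ⟨[], by simp, by simp, by simp, by simp, trivial⟩
    obtain ⟨C, hCU, hCne, hbig, hsmall⟩ := exists_extremal_class τ f Q m hU
    obtain ⟨l, hne, hdis, hsub, hcov, hhull⟩ := ih (U \ C)
      (Finset.sdiff_ssubset hCU hCne) (m + C.card)
    refine ⟨C :: l, ?_, ?_, ?_, ?_, ?_, ?_, hhull⟩
    · simpa [hCne] using hne
    · exact List.pairwise_cons.2
        ⟨fun D hD => Finset.disjoint_of_subset_right (hsub D hD) Finset.disjoint_sdiff, hdis⟩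
    · intro D hD
      rcases List.mem_cons.1 hD with rfl | hD
      · exact hCU
      · exact (hsub D hD).trans Finset.sdiff_subset
    · intro a ha
      by_cases haC : a ∈ C
      · exact ⟨C, by simp, haC⟩
      · obtain ⟨D, hD, haD⟩ := hcov a (by simp [ha, haC])
        exact ⟨D, List.mem_cons_of_mem _ hD, haD⟩
    · intro A B hA hB hd hAB
      refine hsmall A (fun a ha => hCU (hAB ▸ Finset.mem_union_left _ ha)) hA ?_
      rw [← hAB, Finset.card_union_of_disjoint hd]
      have := hB.card_pos
      omega
    · intro D l' hl
      have hD : D ∈ l := by simp [hl]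
      refine hbig _ (Finset.union_subset hCU ((hsub D hD).trans Finset.sdiff_subset)) ?_
      rw [Finset.card_union_of_disjoint
        (Finset.disjoint_of_subset_right (hsub D hD) Finset.disjoint_sdiff)]
      have := (hne D hD).card_pos
      omega

/-- Hulls are invariant under permutations of the nodes that preserve the backlogs. -/
theorem IsHull.map (σ : Equiv.Perm (Fin N)) (hσ : ∀ a, Q (σ a) = Q a) :
    ∀ {l : List (Finset (Fin N))} {m : ℕ}, IsHull τ f Q m l →
    IsHull τ f Q m (l.map (Finset.map σ.toEmbedding))
  | [], _, _ => trivial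
  | C :: l, m, ⟨hsplit, hmerge, htail⟩ => by
    have hdens : ∀ (m : ℕ) (D : Finset (Fin N)),
        density f Q m (D.map σ.toEmbedding) = density f Q m D := by
      intro m D
      simp [density, hσ]
    refine ⟨?_, ?_, ?_⟩
    · intro A B hA hB hd hAB
      have back : ∀ D : Finset (Fin N), (D.map σ.symm.toEmbedding).map σ.toEmbedding = D := by
        intro D
        ext a
        simp
      have := hsplit (A.map σ.symm.toEmbedding) (B.map σ.symm.toEmbedding) (by simpa) (by simpa)
        (by simpa using hd) (by
          rw [← Finset.map_union, hAB]
          ext a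
          simp)
      rwa [← hdens m (A.map _), back, ← hdens m C] at this
    · intro D l' hl
      cases l with
      | nil => simp at hl
      | cons E l =>
        simp only [List.map_cons, List.cons.injEq] at hl
        rw [← hl.1, ← Finset.map_union, hdens, hdens]
        exact hmerge E l rfl
    · rw [Finset.card_map]
      exact IsHull.map σ hσ htail

end Hull

/-! ### Classes of rank orderings and penalties of adjacent orderings. -/

namespace RankOrdering

variable {N : ℕ}

theorem eq_of_classes_eq {R R' : RankOrdering N} (h : R.classes = R'.classes) : R = R' := by
  cases R
  cases R'
  simp only at h
  subst h
  rfl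

theorem cls_of_lt (R : RankOrdering N) {i : ℕ} (hi : i < R.classes.length) :
    R.cls i = R.classes[i] := by
  exact List.getD_eq_getElem _ _ hi

theorem lt_length_of_mem_cls {R : RankOrdering N} {i : ℕ} {a : Fin N} (h : a ∈ R.cls i) :
    i < R.classes.length := by
  by_contra hi
  rw [cls, List.getD_eq_default _ _ (not_lt.1 hi)] at h
  simp at h

theorem exists_mem_cls (R : RankOrdering N) (a : Fin N) : ∃ i, a ∈ R.cls i := by
  obtain ⟨C, hC, ha⟩ := R.cover a
  obtain ⟨i, hi, rfl⟩ := List.getElem_of_mem hC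
  exact ⟨i, by rwa [R.cls_of_lt hi]⟩

theorem disjoint_cls (R : RankOrdering N) {i j : ℕ} (h : i ≠ j) :
    Disjoint (R.cls i) (R.cls j) := by
  rw [Finset.disjoint_left]
  intro a hi hj
  have hi' := lt_length_of_mem_cls hi
  have hj' := lt_length_of_mem_cls hj
  rw [R.cls_of_lt hi'] at hi
  rw [R.cls_of_lt hj'] at hj
  have := List.pairwise_iff_getElem.1 R.disjoint
  rcases lt_or_gt_of_ne h with h | h
  · exact Finset.disjoint_left.1 (this i j hi' hj' h) hi hj
  · exact Finset.disjoint_left.1 (this j i hj' hi' h) hj hi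

theorem cls_index_unique (R : RankOrdering N) {i j : ℕ} {a : Fin N} (hi : a ∈ R.cls i)
    (hj : a ∈ R.cls j) : i = j := by
  by_contra h
  exact Finset.disjoint_left.1 (R.disjoint_cls h) hi hj

theorem Lt.rel {R : RankOrdering N} {r : Finset (Fin N) → Finset (Fin N) → Prop}
    (hr : R.classes.Pairwise r) {a b : Fin N} (h : R.Lt a b) : ∃ C D, r C D ∧ a ∈ C ∧ b ∈ D := by
  obtain ⟨i, j, hij, hi, hj⟩ := h
  have hi' := lt_length_of_mem_cls hi
  have hj' := lt_length_of_mem_cls hj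
  rw [R.cls_of_lt hi'] at hi
  rw [R.cls_of_lt hj'] at hj
  exact ⟨_, _, List.pairwise_iff_getElem.1 hr i j hi' hj' hij, hi, hj⟩

theorem pairwise_of_Lt (R : RankOrdering N) {r : Fin N → Fin N → Prop}
    (h : ∀ a b, R.Lt a b → r a b) : R.classes.Pairwise fun C D => ∀ a ∈ C, ∀ b ∈ D, r a b := by
  rw [List.pairwise_iff_getElem]
  intro i j hi hj hij a ha b hb
  exact h a b ⟨i, j, hij, by rwa [R.cls_of_lt hi], by rwa [R.cls_of_lt hj]⟩

theorem cls_append (R : RankOrdering N) {L₁ L₂ : List (Finset (Fin N))} {C : Finset (Fin N)}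
    (h : R.classes = L₁ ++ C :: L₂) : R.cls L₁.length = C := by
  simp [cls, h]

theorem cls_append_left (R : RankOrdering N) {L₁ L₂ : List (Finset (Fin N))}
    (h : R.classes = L₁ ++ L₂) {i : ℕ} (hi : i < L₁.length) : R.cls i = L₁.getD i ∅ := by
  simp only [cls, h]
  exact List.getD_append _ _ _ _ hi

theorem card_below (R : RankOrdering N) (L₁ : List (Finset (Fin N))) :
    ∀ L₂, R.classes = L₁ ++ L₂ → (R.below L₁.length).card = (L₁.map Finset.card).sum := by
  induction L₁ using List.reverseRecOn with
  | nil => simp [below]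
  | append_singleton L C ih =>
    intro L₂ h
    rw [List.append_assoc] at h
    have hC := R.cls_append (L₁ := L) (C := C) (L₂ := L₂) (by simpa using h)
    have hb : R.below (L ++ [C]).length = R.cls L.length ∪ R.below L.length := by
      simp only [below, List.length_append, List.length_singleton]
      rw [Finset.range_add_one, Finset.biUnion_insert]
    have hd : Disjoint (R.cls L.length) (R.below L.length) := by
      rw [below, Finset.disjoint_biUnion_right]
      intro i hi
      exact R.disjoint_cls (by have := Finset.mem_range.1 hi; omega)
    rw [hb, Finset.card_union_of_disjoint hd, hC, ih _ h]
    simp [add_comm]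

theorem mismatch_eq {R R' : RankOrdering N} {L₁ L₂ L₂' : List (Finset (Fin N))}
    {C C' : Finset (Fin N)} (h : R.classes = L₁ ++ C :: L₂) (h' : R'.classes = L₁ ++ C' :: L₂')
    (hne : C ≠ C') : R.mismatch R' = L₁.length + 1 := by
  rw [mismatch]
  congr 1
  apply le_antisymm
  · refine Nat.sInf_le ?_
    rw [Set.mem_ofPred_eq, R.cls_append h, R'.cls_append h']
    exact hne
  · refine le_csInf ⟨L₁.length, ?_⟩ ?_
    · rw [Set.mem_ofPred_eq, R.cls_append h, R'.cls_append h']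
      exact hne
    · intro i hi
      by_contra hlt
      exact hi (by rw [R.cls_append_left h (not_le.1 hlt), R'.cls_append_left h' (not_le.1 hlt)])

theorem penalty_eq (R : RankOrdering N) (f : ℕ → ℕ → ℝ) (Q : Fin N → ℝ)
    {L₁ L₂ : List (Finset (Fin N))} {C : Finset (Fin N)} (h : R.classes = L₁ ++ C :: L₂) :
    penalty f Q R (L₁.length + 1) =
      (∑ i ∈ Finset.range L₁.length, density f Q ((L₁.take i).map Finset.card).sum (L₁.getD i ∅)) +
        density f Q (L₁.map Finset.card).sum C := by
  rw [penalty, Finset.sum_range_succ]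
  congr 1
  · refine Finset.sum_congr rfl fun i hi => ?_
    have hi := Finset.mem_range.1 hi
    rw [density, R.cls_append_left h hi]
    have := R.card_below (L₁.take i) (L₁.drop i ++ C :: L₂) (by simp [h, ← List.append_assoc])
    rw [List.length_take, min_eq_left hi.le] at this
    rw [this]
  · rw [R.card_below L₁ _ h, R.cls_append h, density]

/-- The classes before the split contribute equally to both penalties, so only the terms of `A ∪ B`
and `A` remain. The tie rule decides equality in exactly one direction, so one and only one of the
two orderings wins. -/
theorem penalizesLess_iff {R R' : RankOrdering N} {f : ℕ → ℕ → ℝ} {Q : Fin N → ℝ} {τ : TieRule}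
    {L₁ L₂ : List (Finset (Fin N))} {A B : Finset (Fin N)}
    (h : R.classes = L₁ ++ (A ∪ B) :: L₂) (h' : R'.classes = L₁ ++ A :: B :: L₂) :
    (PenalizesLess τ f Q R' R ↔ τ.FLt (density f Q (L₁.map Finset.card).sum A)
      (density f Q (L₁.map Finset.card).sum (A ∪ B))) ∧
    (PenalizesLess τ f Q R R' ↔ ¬ τ.FLt (density f Q (L₁.map Finset.card).sum A)
      (density f Q (L₁.map Finset.card).sum (A ∪ B))) := by
  have hdis := R'.disjoint
  rw [h', List.pairwise_append, List.pairwise_cons] at hdis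
  have hd : Disjoint A B := hdis.2.1.1 B (by simp)
  have hBne : B.Nonempty := R'.nonempty B (by simp [h'])
  have hne : A ∪ B ≠ A := by
    intro hAB
    obtain ⟨b, hb⟩ := hBne
    exact Finset.disjoint_left.1 hd (hAB ▸ Finset.mem_union_right A hb) hb
  have hstep : OneStepRefinement R' R := ⟨L₁, L₂, A, B, h, h'⟩
  -- A one-step refinement has exactly one class more, so the relation cannot hold both ways.
  have hnot : ¬ OneStepRefinement R R' := by
    rintro ⟨K₁, K₂, A', B', e, e'⟩
    have e1 := congrArg List.length (h.symm.trans e')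
    have e2 := congrArg List.length (h'.symm.trans e)
    simp at e1 e2
    omega
  have hp := R.penalty_eq f Q h
  have hp' := R'.penalty_eq f Q h'
  rw [PenalizesLess, PenalizesLess, mismatch_eq h h' hne, mismatch_eq h' h hne.symm, hp, hp']
  cases τ <;> simp only [TieRule.Wins, TieRule.FLt, hstep, hnot, and_true, and_false, or_false,
    add_lt_add_iff_left, add_right_inj, not_lt, le_iff_lt_or_eq, true_and, and_self]
  rw [← le_iff_lt_or_eq, not_le]

/-- The ordering obtained by splitting a class. -/
def split (R : RankOrdering N) {L₁ L₂ : List (Finset (Fin N))} {A B : Finset (Fin N)}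
    (h : R.classes = L₁ ++ (A ∪ B) :: L₂) (hA : A.Nonempty) (hB : B.Nonempty)
    (hd : Disjoint A B) : RankOrdering N where
  classes := L₁ ++ A :: B :: L₂
  nonempty C hC := by
    have := R.nonempty C
    rw [h] at this
    simp only [List.mem_append, List.mem_cons] at hC this
    rcases hC with hC | rfl | rfl | hC
    exacts [this (Or.inl hC), hA, hB, this (Or.inr (Or.inr hC))]
  disjoint := by
    have := R.disjoint
    rw [h] at this
    simp only [List.pairwise_append, List.pairwise_cons, List.mem_cons, forall_eq_or_imp,
      Finset.disjoint_union_left, Finset.disjoint_union_right] at this ⊢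
    obtain ⟨h1, ⟨h2, h3⟩, h4⟩ := this
    exact ⟨h1, ⟨⟨hd, fun D hD => (h2 D hD).1⟩, fun D hD => (h2 D hD).2, h3⟩,
      fun D hD => ⟨(h4 D hD).1.1, (h4 D hD).1.2, (h4 D hD).2⟩⟩
  cover a := by
    obtain ⟨C, hC, ha⟩ := R.cover a
    rw [h] at hC
    simp only [List.mem_append, List.mem_cons] at hC ⊢
    rcases hC with hC | rfl | hC
    · exact ⟨C, Or.inl hC, ha⟩
    · rcases Finset.mem_union.1 ha with ha | ha
      · exact ⟨A, by simp, ha⟩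
      · exact ⟨B, by simp, ha⟩
    · exact ⟨C, by simp [hC], ha⟩

/-- The ordering obtained by merging two consecutive classes. -/
def merge (R : RankOrdering N) {L₁ L₂ : List (Finset (Fin N))} {A B : Finset (Fin N)}
    (h : R.classes = L₁ ++ A :: B :: L₂) : RankOrdering N where
  classes := L₁ ++ (A ∪ B) :: L₂
  nonempty C hC := by
    have := R.nonempty
    rw [h] at this
    simp only [List.mem_append, List.mem_cons] at hC this
    rcases hC with hC | rfl | hC
    exacts [this C (Or.inl hC), (this A (by simp)).mono Finset.subset_union_left,
      this C (by simp [hC])]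
  disjoint := by
    have := R.disjoint
    rw [h] at this
    simp only [List.pairwise_append, List.pairwise_cons, List.mem_cons, forall_eq_or_imp,
      Finset.disjoint_union_left, Finset.disjoint_union_right] at this ⊢
    obtain ⟨h1, ⟨⟨hd, h2⟩, h2', h3⟩, h4⟩ := this
    exact ⟨h1, ⟨fun D hD => ⟨h2 D hD, h2' D hD⟩, h3⟩,
      fun D hD => ⟨⟨(h4 D hD).1, (h4 D hD).2.1⟩, (h4 D hD).2.2⟩⟩
  cover a := by
    obtain ⟨C, hC, ha⟩ := R.cover a
    rw [h] at hC
    simp only [List.mem_append, List.mem_cons] at hC ⊢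
    rcases hC with hC | rfl | rfl | hC
    · exact ⟨C, Or.inl hC, ha⟩
    · exact ⟨C ∪ B, by simp, Finset.mem_union_left _ ha⟩
    · exact ⟨A ∪ C, by simp, Finset.mem_union_right _ ha⟩
    · exact ⟨C, by simp [hC], ha⟩

/-- The ordering obtained by permuting the nodes. -/
def permute (R : RankOrdering N) (σ : Equiv.Perm (Fin N)) : RankOrdering N where
  classes := R.classes.map (Finset.map σ.toEmbedding)
  nonempty C hC := by
    obtain ⟨D, hD, rfl⟩ := List.mem_map.1 hC
    simpa using R.nonempty D hD
  disjoint := by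
    rw [List.pairwise_map]
    exact R.disjoint.imp fun h => by simpa using h
  cover a := by
    obtain ⟨C, hC, ha⟩ := R.cover (σ.symm a)
    exact ⟨C.map σ.toEmbedding, List.mem_map_of_mem hC, by simpa using ha⟩

theorem cls_permute (R : RankOrdering N) (σ : Equiv.Perm (Fin N)) (i : ℕ) :
    (R.permute σ).cls i = (R.cls i).map σ.toEmbedding := by
  simp only [cls, permute]
  conv_lhs => rw [← Finset.map_empty σ.toEmbedding]
  rw [List.getD_map]

end RankOrdering

/-! ### Cones as hull conditions; existence and strictness of $\pi_f$. -/

section Cone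

variable {N : ℕ} {f : ℕ → ℕ → ℝ} {Q : Fin N → ℝ} {τ : TieRule}

/-- The recursive form suits induction, while adjacency speaks of decompositions of the whole list.
This translates one into the other, the offset being the number of nodes in the prefix. -/
theorem isHull_iff : ∀ {l : List (Finset (Fin N))} {m : ℕ}, IsHull τ f Q m l ↔
    (∀ L₁ A B L₂, l = L₁ ++ (A ∪ B) :: L₂ → A.Nonempty → B.Nonempty → Disjoint A B →
      ¬ τ.FLt (density f Q (m + (L₁.map Finset.card).sum) A)
        (density f Q (m + (L₁.map Finset.card).sum) (A ∪ B))) ∧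
    (∀ L₁ C D L₂, l = L₁ ++ C :: D :: L₂ →
      τ.FLt (density f Q (m + (L₁.map Finset.card).sum) C)
        (density f Q (m + (L₁.map Finset.card).sum) (C ∪ D)))
  | [], m => by simp [IsHull]
  | E :: l, m => by
    rw [IsHull, isHull_iff (l := l)]
    constructor
    · rintro ⟨h1, h2, h3, h4⟩
      constructor
      · intro L₁ A B L₂ h hA hB hd
        cases L₁ with
        | nil =>
          simp only [List.nil_append, List.cons.injEq] at h
          have := h1 A B hA hB hd h.1.symm
          rw [h.1] at this
          simpa using this
        | cons F L =>
          simp only [List.cons_append, List.cons.injEq] at h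
          have := h3 L A B L₂ h.2 hA hB hd
          simpa [h.1, add_assoc] using this
      · intro L₁ C D L₂ h
        cases L₁ with
        | nil =>
          simp only [List.nil_append, List.cons.injEq] at h
          have := h2 D L₂ h.2
          simpa [h.1] using this
        | cons F L =>
          simp only [List.cons_append, List.cons.injEq] at h
          have := h4 L C D L₂ h.2
          simpa [h.1, add_assoc] using this
    · rintro ⟨h1, h2⟩
      refine ⟨?_, ?_, ?_, ?_⟩
      · intro A B hA hB hd hE
        have := h1 [] A B l (by simp [hE]) hA hB hd
        simpa [hE] using this
      · intro D l' hl
        have := h2 [] E D l' (by simp [hl])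
        simpa using this
      · intro L₁ A B L₂ h hA hB hd
        have := h1 (E :: L₁) A B L₂ (by simp [h]) hA hB hd
        simpa [add_assoc] using this
      · intro L₁ C D L₂ h
        have := h2 (E :: L₁) C D L₂ (by simp [h])
        simpa [add_assoc] using this

/-- Each split of a class into non-empty disjoint parts and each merge of consecutive classes is an
adjacent ordering, and there are no others. -/
theorem mem_cone_iff {R : RankOrdering N} :
    Q ∈ cone τ f R ↔ (∀ a, 0 ≤ Q a) ∧ IsHull τ f Q 0 R.classes := by
  rw [cone, Set.mem_ofPred_eq, isHull_iff]
  simp only [zero_add]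
  refine and_congr_right fun _ => ⟨fun h => ⟨?_, ?_⟩, ?_⟩
  · intro L₁ A B L₂ hl hA hB hd
    exact (RankOrdering.penalizesLess_iff (R' := R.split hl hA hB hd) hl rfl).2.1
      (h _ (Or.inl ⟨L₁, L₂, A, B, hl, rfl⟩))
  · intro L₁ C D L₂ hl
    exact (RankOrdering.penalizesLess_iff (R := R.merge hl) rfl hl).1.1
      (h _ (Or.inr ⟨L₁, L₂, C, D, rfl, hl⟩))
  · rintro ⟨h1, h2⟩ R' (⟨L₁, L₂, A, B, e, e'⟩ | ⟨L₁, L₂, A, B, e, e'⟩)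
    · have hdis := R'.disjoint
      rw [e', List.pairwise_append, List.pairwise_cons] at hdis
      exact (RankOrdering.penalizesLess_iff e e').2.2 (h1 L₁ A B L₂ e (R'.nonempty A (by simp [e']))
        (R'.nonempty B (by simp [e'])) (hdis.2.1.1 B (by simp)))
    · exact (RankOrdering.penalizesLess_iff e e').1.2 (h2 L₁ A B L₂ e')

theorem FLt_of_mem_cone (h0 : ∀ m n, 0 < n → 0 < f m n) (h1 : CondC1 f)
    (h2 : CondC2 f) {R : RankOrdering N} (h : Q ∈ cone τ f R) {j k : Fin N}
    (hjk : R.Lt j k) : τ.FLt (Q j) (Q k) := by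
  rw [mem_cone_iff] at h
  obtain ⟨C, D, hCD, hj, hk⟩ := hjk.rel (h.2.pairwise h0 h1 h2 h.1 R.nonempty R.disjoint)
  exact hCD j hj k hk

/-- Membership in the cone alone may leave equality under the finer rule. If `Q j = Q k`, exchanging
`j` and `k` preserves all densities, so `Q` also lies in the cone of the permuted ordering, which
differs from `R` because the two nodes are in different classes. -/
theorem lt_of_isPi (h0 : ∀ m n, 0 < n → 0 < f m n) (h1 : CondC1 f)
    (h2 : CondC2 f) {R : RankOrdering N} (h : IsPi τ f Q R) {j k : Fin N} (hjk : R.Lt j k) :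
    Q j < Q k := by
  refine lt_of_le_of_ne (FLt_of_mem_cone h0 h1 h2 h.1 hjk).le fun heq => ?_
  have hcone : Q ∈ cone τ f (R.permute (Equiv.swap j k)) := by
    have := mem_cone_iff.1 h.1
    refine mem_cone_iff.2 ⟨this.1, this.2.map _ fun a => ?_⟩
    rcases eq_or_ne a j with rfl | haj
    · simp [heq]
    rcases eq_or_ne a k with rfl | hak
    · simp [heq]
    · rw [Equiv.swap_apply_of_ne_of_ne haj hak]
  obtain ⟨a, b, hab, ha, hb⟩ := hjk
  have hk : k ∈ (R.permute (Equiv.swap j k)).cls a := by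
    rw [R.cls_permute]
    exact Finset.mem_map.2 ⟨j, ha, by simp⟩
  rw [h.2 _ hcone] at hk
  exact hab.ne (R.cls_index_unique hk hb)

theorem exists_mem_cone (f : ℕ → ℕ → ℝ) (τ : TieRule) (hQ : ∀ a, 0 ≤ Q a) : ∃ R, Q ∈ cone τ f R := by
  obtain ⟨l, hne, hdis, -, hcov, hl⟩ := exists_isHull τ f Q Finset.univ 0
  exact ⟨⟨l, hne, hdis, fun a => hcov a (Finset.mem_univ a)⟩, mem_cone_iff.2 ⟨hQ, hl⟩⟩

/-- The greedy hull provides one cone; strict separation in every cone containing `Q` makes the hull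
unique. -/
theorem exists_isPi_of_strict (h0 : ∀ m n, 0 < n → 0 < f m n) (h1 : CondC1 f)
    (hQ : ∀ a, 0 ≤ Q a)
    (hs : ∀ R, Q ∈ cone τ f R → ∀ j k, R.Lt j k → Q j < Q k) : ∃ R, IsPi τ f Q R := by
  obtain ⟨R, hR⟩ := exists_mem_cone f τ hQ
  refine ⟨R, hR, fun R' hR' => RankOrdering.eq_of_classes_eq ?_⟩
  exact IsHull.unique h0 h1 R'.nonempty R.nonempty (R'.pairwise_of_Lt (hs R' hR'))
    (R.pairwise_of_Lt (hs R hR)) (fun a => by simp [R.cover a, R'.cover a])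
    (mem_cone_iff.1 hR').2 (mem_cone_iff.1 hR).2

theorem exists_isPi_coarser (h0 : ∀ m n, 0 < n → 0 < f m n) (h1 : CondC1 f)
    (h2 : CondC2 f) (hQ : ∀ a, 0 ≤ Q a) : ∃ R, IsPi TieRule.coarser f Q R :=
  exists_isPi_of_strict h0 h1 hQ fun _ hR _ _ hjk => FLt_of_mem_cone h0 h1 h2 hR hjk

theorem exists_isPi_finer (h0 : ∀ m n, 0 < n → 0 < f m n) (h1 : CondC1 f)
    (h2 : CondC2 f) (hQ : ∀ a, 0 ≤ Q a) (hinj : Function.Injective Q) :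
    ∃ R, IsPi TieRule.finer f Q R :=
  exists_isPi_of_strict h0 h1 hQ fun R hR j k hjk =>
    lt_of_le_of_ne (FLt_of_mem_cone h0 h1 h2 hR hjk).le fun heq => by
      obtain ⟨a, b, hab, ha, hb⟩ := hjk
      rw [hinj heq] at ha
      exact hab.ne (R.cls_index_unique ha hb)

end Cone

/-! ### Level-set orderings, DIVBAR, and the node selected by backpressure. -/

namespace RankOrdering

variable {N : ℕ}

/-- The ordering whose classes are the level sets of `q`. -/
noncomputable def level (q : Fin N → ℝ) : RankOrdering N where
  classes := ((Finset.univ.image q).sort (· ≤ ·)).map fun x => Finset.univ.filter fun a => q a = x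
  nonempty C hC := by
    obtain ⟨x, hx, rfl⟩ := List.mem_map.1 hC
    obtain ⟨a, -, ha⟩ := Finset.mem_image.1 ((Finset.mem_sort _).1 hx)
    exact ⟨a, by simpa using ha⟩
  disjoint := by
    rw [List.pairwise_map]
    refine (Finset.sort_nodup (Finset.univ.image q) (· ≤ ·)).imp fun {x y} hxy => ?_
    rw [Finset.disjoint_left]
    intro a ha ha'
    simp only [Finset.mem_filter, Finset.mem_univ, true_and] at ha ha'
    exact hxy (ha.symm.trans ha')
  cover a := ⟨_, List.mem_map_of_mem ((Finset.mem_sort _).2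
    (Finset.mem_image_of_mem q (Finset.mem_univ a))), by simp⟩

theorem level_lt (q : Fin N → ℝ) {a b : Fin N} (h : q a < q b) : (level q).Lt a b := by
  obtain ⟨i, hi⟩ := (level q).exists_mem_cls a
  obtain ⟨j, hj⟩ := (level q).exists_mem_cls b
  refine ⟨i, j, ?_, hi, hj⟩
  have hi' := lt_length_of_mem_cls hi
  have hj' := lt_length_of_mem_cls hj
  rw [cls_of_lt _ hi'] at hi
  rw [cls_of_lt _ hj'] at hj
  simp only [level, List.getElem_map, Finset.mem_filter, Finset.mem_univ, true_and] at hi hj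
  by_contra hij
  have := (Finset.pairwise_sort (Finset.univ.image q) (· ≤ ·)).rel_get_of_le
    (a := ⟨j, by simpa [level] using hj'⟩) (b := ⟨i, by simpa [level] using hi'⟩) (not_lt.1 hij)
  simp only [List.get_eq_getElem] at this
  rw [← hi, ← hj] at this
  exact absurd this (not_le.2 h)

theorem level_le (q : Fin N → ℝ) {a b : Fin N} (h : q a ≤ q b) : (level q).Le a b := by
  rcases h.lt_or_eq with h | h
  · exact Or.inl (level_lt q h)
  · obtain ⟨i, hi⟩ := (level q).exists_mem_cls a
    refine Or.inr ⟨i, hi, ?_⟩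
    have hi' := lt_length_of_mem_cls hi
    rw [cls_of_lt _ hi'] at hi ⊢
    simp only [level, List.getElem_map, Finset.mem_filter, Finset.mem_univ, true_and] at hi ⊢
    exact h.symm.trans hi

theorem not_lt_of_le {R : RankOrdering N} {a b : Fin N} (h : R.Le a b) : ¬ R.Lt b a := by
  rintro ⟨i, j, hij, hi, hj⟩
  rcases h with ⟨k, l, hkl, hk, hl⟩ | ⟨k, hk, hl⟩
  · have := R.cls_index_unique hi hl
    have := R.cls_index_unique hj hk
    omega
  · have := R.cls_index_unique hi hl
    have := R.cls_index_unique hj hk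
    omega

end RankOrdering

namespace Scenario

variable {N : ℕ} {net : Network N} {lam : Fin N → ℝ} {Ω : Type} [MeasurableSpace Ω]
  {P : Measure Ω} {X : Scenario net lam P} {μ : Decisions N Ω}

theorem backlog_nonneg (X : Scenario net lam P) (μ : Decisions N Ω) (t : ℕ) (ω : Ω) (i : Node N) :
    0 ≤ X.backlog μ t ω i := by
  cases i with
  | none => simp [backlog]
  | some a =>
    cases t with
    | zero => simpa [backlog] using X.Q₀_nonneg ω a
    | succ t =>
      rw [backlog]
      have h1 : (0 : ℝ) ≤ max (X.backlog μ t ω (some a) - ∑ j, (μ t ω (some a) j : ℝ)) 0 :=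
        le_max_right _ _
      have h2 : (0 : ℝ) ≤ ∑ j, (μ t ω j (some a) : ℝ) *
          (if (μ t ω j (some a) : ℝ) ≤ X.backlog μ t ω j then 1 else 0) :=
        Finset.sum_nonneg fun j _ => by positivity
      have h3 := X.A_nonneg t ω a
      positivity

theorem Q_nonneg (X : Scenario net lam P) (μ : Decisions N Ω) (t : ℕ) (ω : Ω) (a : Fin N) :
    0 ≤ X.Q μ t ω a :=
  X.backlog_nonneg μ t ω _

theorem IsRoutingPolicy.mem_of_eq_one (h : X.IsRoutingPolicy μ) {t : ℕ} {ω : Ω} {i j : Node N}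
    (hj : μ t ω i j = 1) : j ∈ X.S t ω i := by
  by_contra hS
  have := h.le_indicator t ω i j
  simp [hS, hj] at this

theorem IsRoutingPolicy.eq_of_eq_one (h : X.IsRoutingPolicy μ) {t : ℕ} {ω : Ω} {i j k : Node N}
    (hj : μ t ω i j = 1) (hk : μ t ω i k = 1) : j = k := by
  by_contra hjk
  have h1 := h.sum_le_one t ω i
  have h2 : ∑ l ∈ {j, k}, μ t ω i l ≤ ∑ l, μ t ω i l :=
    Finset.sum_le_sum_of_subset (Finset.subset_univ _)
  rw [Finset.sum_pair hjk, hj, hk] at h2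
  omega

/-- The largest differential belongs to the smallest backlog, and if no differential is positive the
transmitter itself attains the minimum. Level sets put equal backlogs into one class, so every way
of breaking ties selects a node of lowest rank. -/
theorem IsDIVBAR.isBackpressure (h : X.IsDIVBAR μ) :
    X.IsBackpressure μ fun t ω => RankOrdering.level (X.Q μ t ω) := by
  have key : ∀ t ω i, ∃ j, μ t ω i j = 1 ∧
      ∀ k ∈ X.S t ω i, (RankOrdering.level (X.Q μ t ω)).NodeLe j k := by
    intro t ω i
    by_cases h0 : none ∈ X.S t ω i
    · exact ⟨none, h.policy.deliver t ω i h0, fun k _ => trivial⟩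
    have hmin : ∀ j ∈ X.S t ω i, (∀ k ∈ X.S t ω i, X.backlog μ t ω j ≤ X.backlog μ t ω k) →
        ∀ k ∈ X.S t ω i, (RankOrdering.level (X.Q μ t ω)).NodeLe j k := by
      intro j hj hle k hk
      cases j with
      | none => exact absurd hj h0
      | some a =>
        cases k with
        | none => exact absurd hk h0
        | some b => exact RankOrdering.level_le _ (hle _ hk)
    by_cases hpos : ∃ j ∈ X.S t ω i, 0 < X.backlog μ t ω i - X.backlog μ t ω j
    · obtain ⟨j, hjS, hj, hle⟩ := h.forward t ω i h0 hpos
      exact ⟨j, hj, hmin j hjS fun k hk => by linarith [hle k hk]⟩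
    · push Not at hpos
      exact ⟨i, h.retain t ω i h0 hpos, hmin i (X.S_self t ω i) fun k hk => by
        linarith [hpos k hk]⟩
  refine ⟨⟨h.policy, fun t ω i => ?_, fun t ω i j hj => ?_⟩, fun t ω a b hab =>
    RankOrdering.level_lt _ hab⟩
  · obtain ⟨j, hj, -⟩ := key t ω i
    exact ⟨j, hj⟩
  · obtain ⟨k, hk, hle⟩ := key t ω i
    rw [h.policy.eq_of_eq_one hj hk]
    exact ⟨h.policy.mem_of_eq_one hk, hle⟩

/-- Backpressure selects a potential forwarder with the smallest backlog. -/
theorem IsBackpressure.backlog_le {R : ℕ → Ω → RankOrdering N} (h : X.IsBackpressure μ R) {t : ℕ}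
    {ω : Ω} {i j k : Node N} (hj : μ t ω i j = 1) (hk : k ∈ X.S t ω i) :
    X.backlog μ t ω j ≤ X.backlog μ t ω k := by
  have hle := (h.priority.lowest t ω i j hj).2 k hk
  cases j with
  | none => simpa [backlog] using X.backlog_nonneg μ t ω k
  | some a =>
    cases k with
    | none => exact hle.elim
    | some b =>
      by_contra hcon
      exact RankOrdering.not_lt_of_le hle (h.smaller_lower t ω b a (not_le.1 hcon))

end Scenario

/-! ### Measurability of backlogs and independence from the current slot. -/

namespace Scenario

variable {N : ℕ} {net : Network N} {lam : Fin N → ℝ} {Ω : Type} [mΩ : MeasurableSpace Ω]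
  {P : Measure Ω} {X : Scenario net lam P} {μ : Decisions N Ω}

/-- The σ-field of the independent sources of randomness: the initial backlogs (`none`) and the
arrivals and potential forwarders of slot `t` (`some t`). -/
@[reducible] noncomputable def source (X : Scenario net lam P) : Option ℕ → MeasurableSpace Ω
  | none => MeasurableSpace.comap X.Q₀ inferInstance
  | some t => MeasurableSpace.comap (fun ω => (X.A t ω, X.S t ω)) inferInstance

/-- The σ-field of everything that happens before slot `t`. -/
@[reducible] noncomputable def past (X : Scenario net lam P) (t : ℕ) : MeasurableSpace Ω :=
  ⨆ o ∈ {o : Option ℕ | ∀ s ∈ o, s < t}, X.source o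

theorem source_le (X : Scenario net lam P) (o : Option ℕ) : X.source o ≤ mΩ := by
  cases o with
  | none => exact X.measurable_Q₀.comap_le
  | some t => exact ((X.measurable_A t).prodMk (X.measurable_S t)).comap_le

theorem past_le (X : Scenario net lam P) (t : ℕ) : X.past t ≤ mΩ :=
  iSup₂_le fun o _ => X.source_le o

theorem past_mono (X : Scenario net lam P) {s t : ℕ} (h : s ≤ t) : X.past s ≤ X.past t :=
  biSup_mono fun _ ho r hr => (ho r hr).trans_le h

theorem source_le_past (X : Scenario net lam P) {s t : ℕ} (h : s < t) :
    X.source (some s) ≤ X.past t :=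
  le_iSup₂_of_le (some s) (fun r hr => by
    rw [Option.mem_some_iff] at hr
    omega) le_rfl

/-- Independence over time and independence of the initial backlogs from the whole process combine
into mutual independence of all sources. -/
theorem iIndep_source [IsProbabilityMeasure P] (X : Scenario net lam P) : iIndep X.source P := by
  classical
  rw [iIndep_iff]
  intro s F hF
  have htime : ∀ (u : Finset ℕ) (G : ℕ → Set Ω),
      (∀ t ∈ u, MeasurableSet[X.source (some t)] (G t)) →
      P (⋂ t ∈ u, G t) = ∏ t ∈ u, P (G t) :=
    fun u G hG => (iIndep_iff _ _).1 ((iIndepFun_iff_iIndep _ _ _).1 X.indep_time) u hG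
  have hsome : ⋂ o ∈ s.filter (fun o => o ≠ none), F o = ⋂ t ∈ s.eraseNone, F (some t) := by
    ext ω
    simp only [Finset.mem_filter, Set.mem_iInter, Finset.mem_eraseNone]
    refine ⟨fun h t ht => h _ ⟨ht, by simp⟩, fun h o ho => ?_⟩
    cases o with
    | none => exact absurd rfl ho.2
    | some t => exact h t ho.1
  have hprod : ∏ o ∈ s.filter (fun o => o ≠ none), P (F o) = ∏ t ∈ s.eraseNone, P (F (some t)) := by
    symm
    refine Finset.prod_bij (fun t _ => some t) (fun t ht => by simpa using ht)
      (fun a _ b _ h => by simpa using h) (fun o ho => ?_) fun t _ => rfl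
    cases o with
    | none => simp at ho
    | some t => exact ⟨t, by simpa using ho, rfl⟩
  have ht := htime s.eraseNone (fun t => F (some t)) fun t ht => hF _ (by simpa using ht)
  by_cases h0 : none ∈ s
  · have hs : s = insert none (s.filter fun o => o ≠ none) := by
      ext o
      by_cases ho : o = none <;> simp [ho, h0]
    rw [hs, Finset.set_biInter_insert, Finset.prod_insert (by simp), hsome, hprod, ← ht]
    -- The intersection over the slots is an event of the entire process of arrivals and forwarders,
    -- hence independent of the initial backlogs.
    have hind := (IndepFun_iff_Indep _ _ _).1 X.indep_init
    refine (Indep_iff _ _ _).1 hind _ _ (hF none h0) ?_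
    refine Finset.measurableSet_biInter _ fun t ht => ?_
    obtain ⟨B, hB, hBF⟩ := hF (some t) (by simpa using ht)
    exact ⟨{y | y t ∈ B}, measurable_pi_apply t hB, hBF⟩
  · have hs : s = s.filter fun o => o ≠ none := by
      ext o
      by_cases ho : o = none <;> simp [ho, h0]
    rw [hs, hsome, hprod, ht]

theorem indep_past [IsProbabilityMeasure P] (X : Scenario net lam P) (t : ℕ) :
    Indep (X.past t) (X.source (some t)) P := by
  have := indep_iSup_of_disjoint X.source_le X.iIndep_source
    (S := {o : Option ℕ | ∀ s ∈ o, s < t}) (T := {some t})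
    (by
      rw [Set.disjoint_singleton_right]
      intro h
      exact lt_irrefl _ (h t rfl))
  rwa [iSup_singleton] at this

/-- The history contains the policy's own earlier decisions and backlogs, so a strong induction is
needed to express everything through the sources. Decisions of slot `t` may use the forwarders of
that slot, hence `t + 1`; backlogs may not, and this makes them independent of slot `t`. -/
theorem IsRoutingPolicy.measurable_past (h : X.IsRoutingPolicy μ) (t : ℕ) :
    (∀ i, Measurable[X.past t] fun ω => X.backlog μ t ω i) ∧
      ∀ i j, Measurable[X.past (t + 1)] fun ω => μ t ω i j := by
  induction t using Nat.strong_induction_on with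
  | _ t ih =>
  have hQ : ∀ i, Measurable[X.past t] fun ω => X.backlog μ t ω i := by
    intro i
    cases i with
    | none => simp only [backlog]; exact measurable_const
    | some a =>
      cases t with
      | zero =>
        simp only [backlog]
        have h0 : Measurable[X.source none] X.Q₀ := comap_measurable _
        have h1 : Measurable[X.past 0] X.Q₀ :=
          h0.mono (le_iSup₂_of_le none (by simp) le_rfl) le_rfl
        exact (measurable_pi_apply a).comp h1
      | succ t =>
        obtain ⟨ihQ, ihμ⟩ := ih t (Nat.lt_succ_self t)
        have hQ' : ∀ i, Measurable[X.past (t + 1)] fun ω => X.backlog μ t ω i := fun i =>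
          (ihQ i).mono (X.past_mono t.le_succ) le_rfl
        have hμ' : ∀ i j, Measurable[X.past (t + 1)] fun ω => (μ t ω i j : ℝ) := fun i j =>
          (measurable_of_countable (fun n : ℕ => (n : ℝ))).comp (ihμ i j)
        have hAS : Measurable[X.past (t + 1)] fun ω => (X.A t ω, X.S t ω) :=
          (comap_measurable _).mono (X.source_le_past t.lt_succ_self) le_rfl
        have hA : Measurable[X.past (t + 1)] fun ω => X.A t ω a :=
          (measurable_pi_apply a).comp (measurable_fst.comp hAS)
        simp only [backlog]
        refine Measurable.add (Measurable.add ?_ ?_) hA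
        · have hg : Measurable fun x : ℝ => max x 0 := measurable_id.max measurable_const
          exact hg.comp ((hQ' _).sub (Finset.measurable_sum _ fun j _ => hμ' _ j))
        · have hg : Measurable fun p : ℝ × ℝ => p.1 * if p.1 ≤ p.2 then (1 : ℝ) else 0 :=
            measurable_fst.mul (Measurable.ite (measurableSet_le measurable_fst measurable_snd)
              measurable_const measurable_const)
          exact Finset.measurable_sum _ fun j _ => hg.comp ((hμ' j _).prodMk (hQ' j))
  refine ⟨hQ, fun i j => ?_⟩
  have hhist : X.history μ t ≤ X.past (t + 1) := by
    refine sup_le (iSup₂_le fun s hs => iSup_le fun k => sup_le ?_ ?_)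
      (iSup₂_le fun s hs => iSup₂_le fun k l => ?_)
    · refine Measurable.comap_le ?_
      rcases (Set.mem_Iic.1 hs).lt_or_eq with hlt | rfl
      · exact ((ih s hlt).1 k).mono (X.past_mono (by omega)) le_rfl
      · exact (hQ k).mono (X.past_mono (by omega)) le_rfl
    · have hAS : Measurable[X.past (t + 1)] fun ω => (X.A s ω, X.S s ω) :=
        (comap_measurable _).mono (X.source_le_past (Nat.lt_succ_of_le hs)) le_rfl
      exact Measurable.comap_le ((measurable_pi_apply k).comp (measurable_snd.comp hAS))
    · have hs := Set.mem_Iio.1 hs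
      exact Measurable.comap_le (((ih s hs).2 k l).mono (X.past_mono (by omega)) le_rfl)
  exact @measurable_to_countable' _ _ _ _ (X.past (t + 1)) _ fun θ => hhist _ (h.adapted t i j θ)

theorem IsRoutingPolicy.measurable_backlog (h : X.IsRoutingPolicy μ) (t : ℕ) (i : Node N) :
    Measurable fun ω => X.backlog μ t ω i :=
  ((h.measurable_past t).1 i).mono (X.past_le t) le_rfl

theorem IsRoutingPolicy.measurable_decision (h : X.IsRoutingPolicy μ) (t : ℕ) (i j : Node N) :
    Measurable fun ω => μ t ω i j :=
  ((h.measurable_past t).2 i j).mono (X.past_le _) le_rfl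

/-- The backlogs of a slot are independent of its arrivals and potential forwarders. -/
theorem IsRoutingPolicy.integral_backlog_mul [IsProbabilityMeasure P] (h : X.IsRoutingPolicy μ)
    (t : ℕ) (i : Node N) {g : (Fin N → ℝ) × (Node N → Finset (Node N)) → ℝ} (hg : Measurable g) :
    ∫ ω, X.backlog μ t ω i * g (X.A t ω, X.S t ω) ∂P =
      (∫ ω, X.backlog μ t ω i ∂P) * ∫ ω, g (X.A t ω, X.S t ω) ∂P := by
  have hAS : Measurable fun ω => (X.A t ω, X.S t ω) := (X.measurable_A t).prodMk (X.measurable_S t)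
  have hind : IndepFun (fun ω => X.backlog μ t ω i) (fun ω => g (X.A t ω, X.S t ω)) P := by
    rw [IndepFun_iff_Indep]
    refine indep_of_indep_of_le_left (indep_of_indep_of_le_right (X.indep_past t) ?_) ?_
    · exact Measurable.comap_le (hg.comp (comap_measurable _))
    · exact Measurable.comap_le ((h.measurable_past t).1 i)
  exact hind.integral_fun_mul_eq_mul_integral (h.measurable_backlog t i).aestronglyMeasurable
    (hg.comp hAS).aestronglyMeasurable

end Scenario

/-! ### Lyapunov drift of backpressure compared with stationary routing. -/

/-- Stationary randomized routing under which every node has at least `δ` spare capacity: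
`ψ b s j` is the probability that the potential forwarders of `b` are `s` and that `j` takes the
packet. -/
structure StationaryRouting {N : ℕ} (net : Network N) (lam : Fin N → ℝ) (δ : ℝ)
    (ψ : Fin N → Finset (Node N) → Node N → ℝ) : Prop where
  nonneg : ∀ b s j, 0 ≤ ψ b s j
  support : ∀ b s j, j ∉ s → ψ b s j = 0
  sum_le : ∀ b s, ∑ j, ψ b s j ≤ net.prob (some b) s
  balance : ∀ a, lam a + δ + ∑ b, ∑ s, ψ b s (some a) ≤ ∑ s, ∑ j, ψ a s j

/-- Summation by parts: differentials summed over links become net inflows summed over nodes. It is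
used for actual decisions and again for mean flows. -/
theorem sum_flow_mul_sub {N : ℕ} (w : Fin N → Node N → ℝ) (q : Node N → ℝ) (h0 : q none = 0) :
    ∑ b, ∑ j, w b j * (q j - q (some b)) =
      ∑ a, q (some a) * (∑ b, w b (some a) - ∑ j, w a j) := by
  have h1 : ∑ b, ∑ j, w b j * q j = ∑ a, q (some a) * ∑ b, w b (some a) := by
    simp_rw [Fintype.sum_option, h0, mul_zero, zero_add, Finset.mul_sum]
    rw [Finset.sum_comm]
    exact Finset.sum_congr rfl fun a _ => Finset.sum_congr rfl fun b _ => mul_comm _ _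
  have h2 : ∑ b, ∑ j, w b j * q (some b) = ∑ a, q (some a) * ∑ j, w a j :=
    Finset.sum_congr rfl fun a _ => by rw [← Finset.sum_mul, mul_comm]
  simp only [mul_sub, Finset.sum_sub_distrib, h1, h2]

namespace StationaryRouting

variable {N : ℕ} {net : Network N} {lam : Fin N → ℝ} {δ : ℝ}
  {ψ : Fin N → Finset (Node N) → Node N → ℝ}

/-- The quotient is the conditional probability of choosing `j`. Where `s` has probability zero, `ψ`
vanishes too, so the default value of the division is harmless. -/
theorem prob_mul_div (h : StationaryRouting net lam δ ψ) (b : Fin N) (s : Finset (Node N))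
    (j : Node N) : net.prob (some b) s * (ψ b s j / net.prob (some b) s) = ψ b s j := by
  rcases eq_or_ne (net.prob (some b) s) 0 with h0 | h0
  · have h1 : ψ b s j ≤ ∑ j, ψ b s j :=
      Finset.single_le_sum (fun j _ => h.nonneg b s j) (Finset.mem_univ j)
    have := h.sum_le b s
    have := h.nonneg b s j
    rw [h0, zero_mul]
    linarith
  · exact mul_div_cancel₀ _ h0

theorem div_nonneg (h : StationaryRouting net lam δ ψ) (b : Fin N) (s : Finset (Node N))
    (j : Node N) : 0 ≤ ψ b s j / net.prob (some b) s :=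
  _root_.div_nonneg (h.nonneg b s j) (net.prob_nonneg _ _)

theorem sum_div_le_one (h : StationaryRouting net lam δ ψ) (b : Fin N) (s : Finset (Node N)) :
    ∑ j, ψ b s j / net.prob (some b) s ≤ 1 := by
  rw [← Finset.sum_div]
  exact div_le_one_of_le₀ (h.sum_le b s) (net.prob_nonneg _ _)

end StationaryRouting

namespace Scenario

variable {N : ℕ} {net : Network N} {lam : Fin N → ℝ} {Ω : Type} [MeasurableSpace Ω]
  {P : Measure Ω} {X : Scenario net lam P} {μ : Decisions N Ω}

theorem IsRoutingPolicy.decision_le_one (h : X.IsRoutingPolicy μ) (t : ℕ) (ω : Ω)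
    (i j : Node N) : (μ t ω i j : ℝ) ≤ 1 := by
  have := h.le_indicator t ω i j
  have : μ t ω i j ≤ 1 := this.trans (by split_ifs <;> simp)
  exact_mod_cast this

theorem IsRoutingPolicy.sum_cast_le_one (h : X.IsRoutingPolicy μ) (t : ℕ) (ω : Ω) (i : Node N) :
    ∑ j, (μ t ω i j : ℝ) ≤ 1 := by
  exact_mod_cast h.sum_le_one t ω i

theorem IsRoutingPolicy.inflow_le (h : X.IsRoutingPolicy μ) (t : ℕ) (ω : Ω) (j : Node N) :
    ∑ i, (μ t ω i j : ℝ) ≤ N + 1 := by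
  calc ∑ i, (μ t ω i j : ℝ) ≤ ∑ _i : Node N, (1 : ℝ) :=
        Finset.sum_le_sum fun i _ => h.decision_le_one t ω i j
    _ = N + 1 := by simp

/-- The destination never passes a packet on. -/
theorem IsRoutingPolicy.decision_none (h : X.IsRoutingPolicy μ) (t : ℕ) (ω : Ω) (a : Fin N) :
    μ t ω none (some a) = 0 := by
  have h1 := h.deliver t ω none (X.S_self t ω none)
  have h2 := h.sum_le_one t ω none
  have h3 : ∑ l ∈ {none, some a}, μ t ω none l ≤ ∑ l, μ t ω none l :=
    Finset.sum_le_sum_of_subset (Finset.subset_univ _)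
  rw [Finset.sum_pair (by simp), h1] at h3
  omega

theorem backlog_succ_le (X : Scenario net lam P) (μ : Decisions N Ω) (t : ℕ) (ω : Ω) (a : Fin N) :
    X.backlog μ (t + 1) ω (some a) ≤
      max (X.backlog μ t ω (some a) - ∑ j, (μ t ω (some a) j : ℝ)) 0
        + ∑ j, (μ t ω j (some a) : ℝ) + X.A t ω a := by
  rw [backlog]
  gcongr with j
  split_ifs <;> simp

theorem IsRoutingPolicy.backlog_succ_le_add (h : X.IsRoutingPolicy μ) {Amax : ℝ}
    (hA : ∀ t ω a, X.A t ω a ≤ Amax) (t : ℕ) (ω : Ω) (a : Fin N) :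
    X.backlog μ (t + 1) ω (some a) ≤ X.backlog μ t ω (some a) + (N + 1 + Amax) := by
  have h1 := X.backlog_succ_le μ t ω a
  have h2 := h.inflow_le t ω (some a)
  have h3 := hA t ω a
  have h4 : (0 : ℝ) ≤ ∑ j, (μ t ω (some a) j : ℝ) := Finset.sum_nonneg fun j _ => by positivity
  have h5 : max (X.backlog μ t ω (some a) - ∑ j, (μ t ω (some a) j : ℝ)) 0 ≤
      X.backlog μ t ω (some a) := max_le (by linarith) (X.backlog_nonneg μ t ω _)
  linarith

/-- A slot raises a backlog by at most a constant, so square integrability is inherited from the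
initial backlogs. This makes the quadratic Lyapunov function integrable. -/
theorem IsRoutingPolicy.memLp_backlog [IsProbabilityMeasure P] (h : X.IsRoutingPolicy μ) (t : ℕ)
    (i : Node N) : MemLp (fun ω => X.backlog μ t ω i) 2 P := by
  cases i with
  | none => simp only [backlog]; exact memLp_const 0
  | some a =>
    obtain ⟨Amax, hA⟩ := X.A_bdd
    induction t with
    | zero => simpa only [backlog] using X.Q₀_sq a
    | succ t ih =>
      refine (ih.add (memLp_const (N + 1 + Amax))).mono
        (h.measurable_backlog (t + 1) _).aestronglyMeasurable (Filter.Eventually.of_forall fun ω => ?_)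
      rw [Real.norm_of_nonneg (X.backlog_nonneg μ _ ω _)]
      exact (h.backlog_succ_le_add hA t ω a).trans (le_abs_self _)

theorem IsRoutingPolicy.integrable_backlog [IsProbabilityMeasure P] (h : X.IsRoutingPolicy μ)
    (t : ℕ) (i : Node N) : Integrable (fun ω => X.backlog μ t ω i) P :=
  (h.memLp_backlog t i).integrable one_le_two

/-- The one-slot growth of the squared backlog. -/
theorem IsRoutingPolicy.sq_backlog_succ_le (h : X.IsRoutingPolicy μ) {Amax : ℝ}
    (hA : ∀ t ω a, X.A t ω a ≤ Amax) (t : ℕ) (ω : Ω) (a : Fin N) :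
    X.backlog μ (t + 1) ω (some a) ^ 2 ≤ X.backlog μ t ω (some a) ^ 2 + (1 + (N + 1 + Amax) ^ 2) +
      2 * (X.backlog μ t ω (some a) * X.A t ω a + X.backlog μ t ω (some a) *
        (∑ j, (μ t ω j (some a) : ℝ) - ∑ j, (μ t ω (some a) j : ℝ))) := by
  have h1 := X.backlog_succ_le μ t ω a
  have h2 := h.inflow_le t ω (some a)
  have h3 := hA t ω a
  have h4 : (0 : ℝ) ≤ ∑ j, (μ t ω (some a) j : ℝ) := Finset.sum_nonneg fun j _ => by positivity
  have h5 := h.sum_cast_le_one t ω (some a)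
  have h6 : (0 : ℝ) ≤ ∑ j, (μ t ω j (some a) : ℝ) := Finset.sum_nonneg fun j _ => by positivity
  have h7 := X.A_nonneg t ω a
  have h8 := X.backlog_nonneg μ (t + 1) ω (some a)
  have hq := X.backlog_nonneg μ t ω (some a)
  generalize X.backlog μ (t + 1) ω (some a) = q' at *
  generalize X.backlog μ t ω (some a) = q at *
  generalize ∑ j, (μ t ω (some a) j : ℝ) = o at *
  generalize ∑ j, (μ t ω j (some a) : ℝ) = i at *
  generalize X.A t ω a = α at *
  have hm0 : 0 ≤ max (q - o) 0 := le_max_right _ _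
  have hm1 : max (q - o) 0 ≤ q := max_le (by linarith) hq
  have hm2 : max (q - o) 0 ^ 2 ≤ (q - o) ^ 2 := by
    rw [sq_le_sq, abs_of_nonneg hm0]
    exact max_le (le_abs_self _) (abs_nonneg _)
  have e1 : q' ^ 2 ≤ (max (q - o) 0 + (i + α)) ^ 2 := pow_le_pow_left₀ h8 (by linarith) 2
  have e2 : (i + α) ^ 2 ≤ (N + 1 + Amax) ^ 2 := pow_le_pow_left₀ (by linarith) (by linarith) 2
  have e3 : max (q - o) 0 * (i + α) ≤ q * (i + α) := mul_le_mul_of_nonneg_right hm1 (by linarith)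
  have e4 : o ^ 2 ≤ 1 := pow_le_one₀ h4 h5
  -- Expanding `e1`, the squares contribute `q ^ 2 - 2 * q * o + o ^ 2` and the cross term at most
  -- `2 * q * (i + α)`. The remaining squares are bounded by `1` and `(N + 1 + Amax) ^ 2`.
  nlinarith

/-- The drift achieved by the stationary randomized routing. -/
noncomputable def stationaryDrift (X : Scenario net lam P) (μ : Decisions N Ω)
    (ψ : Fin N → Finset (Node N) → Node N → ℝ) (t : ℕ) (ω : Ω) : ℝ :=
  ∑ b : Fin N, ∑ j : Node N, ψ b (X.S t ω (some b)) j / net.prob (some b) (X.S t ω (some b)) *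
    (X.backlog μ t ω j - X.backlog μ t ω (some b))

/-- Backpressure has the smallest drift. -/
theorem IsBackpressure.drift_le {R : ℕ → Ω → RankOrdering N} (h : X.IsBackpressure μ R) {δ : ℝ}
    {ψ : Fin N → Finset (Node N) → Node N → ℝ} (hψ : StationaryRouting net lam δ ψ) (t : ℕ)
    (ω : Ω) :
    ∑ a, X.backlog μ t ω (some a) *
        (∑ j, (μ t ω j (some a) : ℝ) - ∑ j, (μ t ω (some a) j : ℝ)) ≤
      X.stationaryDrift μ ψ t ω := by
  have hpol := h.priority.policy
  have hin : ∀ a, ∑ j, (μ t ω j (some a) : ℝ) = ∑ b, (μ t ω (some b) (some a) : ℝ) := fun a => by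
    rw [Fintype.sum_option, hpol.decision_none]
    simp
  simp_rw [hin]
  rw [← sum_flow_mul_sub (fun b j => (μ t ω (some b) j : ℝ)) (X.backlog μ t ω) (by simp [backlog])]
  refine Finset.sum_le_sum fun b _ => ?_
  obtain ⟨k, hk⟩ := h.priority.selects t ω (some b)
  have hleft : ∑ j, (μ t ω (some b) j : ℝ) * (X.backlog μ t ω j - X.backlog μ t ω (some b)) =
      X.backlog μ t ω k - X.backlog μ t ω (some b) := by
    rw [Finset.sum_eq_single k]
    · simp [hk]
    · intro j _ hjk
      have : μ t ω (some b) j = 0 := by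
        by_contra hne
        have h1 := hpol.sum_le_one t ω (some b)
        have h2 : ∑ l ∈ {j, k}, μ t ω (some b) l ≤ ∑ l, μ t ω (some b) l :=
          Finset.sum_le_sum_of_subset (Finset.subset_univ _)
        rw [Finset.sum_pair hjk, hk] at h2
        omega
      simp [this]
    · simp
  rw [hleft]
  -- The transmitter is one of its own potential forwarders. As the differential is nonpositive,
  -- scaling it by a total probability of at most one can only increase it.
  have hneg : X.backlog μ t ω k - X.backlog μ t ω (some b) ≤ 0 := by
    linarith [h.backlog_le hk (X.S_self t ω (some b))]
  calc X.backlog μ t ω k - X.backlog μ t ω (some b)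
      ≤ (∑ j, ψ b (X.S t ω (some b)) j / net.prob (some b) (X.S t ω (some b))) *
          (X.backlog μ t ω k - X.backlog μ t ω (some b)) := by
        nlinarith [hψ.sum_div_le_one b (X.S t ω (some b))]
    _ ≤ _ := by
        rw [Finset.sum_mul]
        refine Finset.sum_le_sum fun j _ => ?_
        by_cases hj : j ∈ X.S t ω (some b)
        · exact mul_le_mul_of_nonneg_left (by linarith [h.backlog_le hk hj])
            (hψ.div_nonneg b _ j)
        · simp [hψ.support b _ j hj]

theorem integral_comp_S [IsProbabilityMeasure P] (X : Scenario net lam P) (t : ℕ) (i : Node N)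
    (g : Finset (Node N) → ℝ) : ∫ ω, g (X.S t ω i) ∂P = ∑ s, net.prob i s * g s := by
  have hm : Measurable fun ω => X.S t ω i := (measurable_pi_apply i).comp (X.measurable_S t)
  have : Measure.map (fun ω => X.S t ω i) P Set.univ = 1 := by
    rw [Measure.map_apply hm MeasurableSet.univ]; simp
  have : IsProbabilityMeasure (Measure.map (fun ω => X.S t ω i) P) := ⟨this⟩
  rw [← integral_map hm.aemeasurable (measurable_of_countable g).aestronglyMeasurable,
    integral_fintype Integrable.of_finite]
  refine Finset.sum_congr rfl fun s _ => ?_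
  rw [← X.S_law t i s, map_measureReal_apply hm (measurableSet_singleton s), smul_eq_mul]
  rfl

theorem measurable_arrival (X : Scenario net lam P) (t : ℕ) (a : Fin N) :
    Measurable fun ω => X.A t ω a :=
  (measurable_pi_apply a).comp (X.measurable_A t)

theorem integral_arrival (X : Scenario net lam P) (t : ℕ) (a : Fin N) :
    ∫ ω, X.A t ω a ∂P = lam a := by
  rw [← X.A_mean a]
  exact ((X.A_ident t).comp (measurable_pi_apply a)).integral_eq

theorem IsRoutingPolicy.integrable_backlog_mul_arrival [IsProbabilityMeasure P]
    (h : X.IsRoutingPolicy μ) (t : ℕ) (a : Fin N) :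
    Integrable (fun ω => X.backlog μ t ω (some a) * X.A t ω a) P := by
  obtain ⟨Amax, hA⟩ := X.A_bdd
  refine (h.integrable_backlog t (some a)).mul_bdd (c := Amax)
    (X.measurable_arrival t a).aestronglyMeasurable (Filter.Eventually.of_forall fun ω => ?_)
  rw [Real.norm_of_nonneg (X.A_nonneg t ω a)]
  exact hA t ω a

theorem IsRoutingPolicy.integrable_backlog_mul_comp_S [IsProbabilityMeasure P]
    (h : X.IsRoutingPolicy μ) (t : ℕ) (k i : Node N) (g : Finset (Node N) → ℝ) :
    Integrable (fun ω => X.backlog μ t ω k * g (X.S t ω i)) P := by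
  have hm : Measurable fun ω => X.S t ω i := (measurable_pi_apply i).comp (X.measurable_S t)
  refine (h.integrable_backlog t k).mul_bdd (c := ∑ s, ‖g s‖)
    ((measurable_of_countable g).comp hm).aestronglyMeasurable
    (Filter.Eventually.of_forall fun ω => ?_)
  exact Finset.single_le_sum (f := fun s => ‖g s‖) (fun s _ => norm_nonneg _) (Finset.mem_univ _)

theorem IsRoutingPolicy.integral_backlog_mul_arrival [IsProbabilityMeasure P]
    (h : X.IsRoutingPolicy μ) (t : ℕ) (a : Fin N) :
    ∫ ω, X.backlog μ t ω (some a) * X.A t ω a ∂P =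
      (∫ ω, X.backlog μ t ω (some a) ∂P) * lam a := by
  have := h.integral_backlog_mul t (some a) (g := fun p => p.1 a)
    ((measurable_pi_apply a).comp measurable_fst)
  rwa [X.integral_arrival] at this

theorem IsRoutingPolicy.integral_backlog_mul_comp_S [IsProbabilityMeasure P]
    (h : X.IsRoutingPolicy μ) (t : ℕ) (k i : Node N) (g : Finset (Node N) → ℝ) :
    ∫ ω, X.backlog μ t ω k * g (X.S t ω i) ∂P =
      (∫ ω, X.backlog μ t ω k ∂P) * ∑ s, net.prob i s * g s := by
  have := h.integral_backlog_mul t k (g := fun p => g (p.2 i))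
    ((measurable_of_countable g).comp ((measurable_pi_apply i).comp measurable_snd))
  rwa [X.integral_comp_S t i g] at this

/-- Each term is a backlog times a function of the current forwarders, the form in which
independence factors the expectation. -/
theorem stationaryDrift_eq (X : Scenario net lam P) (μ : Decisions N Ω)
    (ψ : Fin N → Finset (Node N) → Node N → ℝ) (t : ℕ) (ω : Ω) :
    X.stationaryDrift μ ψ t ω = ∑ b : Fin N, ∑ j : Node N,
      (X.backlog μ t ω j *
          (fun s => ψ b s j / net.prob (some b) s) (X.S t ω (some b)) -
        X.backlog μ t ω (some b) *
          (fun s => ψ b s j / net.prob (some b) s) (X.S t ω (some b))) := by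
  refine Finset.sum_congr rfl fun b _ => Finset.sum_congr rfl fun j _ => ?_
  ring

theorem IsRoutingPolicy.integrable_stationaryDrift [IsProbabilityMeasure P]
    (h : X.IsRoutingPolicy μ) (ψ : Fin N → Finset (Node N) → Node N → ℝ) (t : ℕ) :
    Integrable (X.stationaryDrift μ ψ t) P := by
  have : X.stationaryDrift μ ψ t = _ := funext (stationaryDrift_eq X μ ψ t)
  rw [this]
  exact integrable_finsetSum _ fun b _ => integrable_finsetSum _ fun j _ =>
    (h.integrable_backlog_mul_comp_S t j (some b) fun s => ψ b s j / net.prob (some b) s).sub'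
      (h.integrable_backlog_mul_comp_S t (some b) (some b) fun s => ψ b s j / net.prob (some b) s)

theorem IsRoutingPolicy.integral_stationaryDrift_le [IsProbabilityMeasure P]
    (h : X.IsRoutingPolicy μ) {δ : ℝ} {ψ : Fin N → Finset (Node N) → Node N → ℝ}
    (hψ : StationaryRouting net lam δ ψ) (t : ℕ) :
    ∫ ω, X.stationaryDrift μ ψ t ω ∂P ≤
      -∑ a, (∫ ω, X.backlog μ t ω (some a) ∂P) * (lam a + δ) := by
  have hint := fun (k : Node N) (b : Fin N) (j : Node N) =>
    h.integrable_backlog_mul_comp_S t k (some b) fun s => ψ b s j / net.prob (some b) s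
  have heq : ∫ ω, X.stationaryDrift μ ψ t ω ∂P = ∑ b : Fin N, ∑ j : Node N,
      (∑ s, ψ b s j) * ((∫ ω, X.backlog μ t ω j ∂P) - ∫ ω, X.backlog μ t ω (some b) ∂P) := by
    simp_rw [stationaryDrift_eq X μ ψ t]
    rw [integral_finsetSum _ fun b _ => integrable_finsetSum _ fun j _ =>
      (hint j b j).sub' (hint (some b) b j)]
    refine Finset.sum_congr rfl fun b _ => ?_
    rw [integral_finsetSum _ fun j _ => (hint j b j).sub' (hint (some b) b j)]
    refine Finset.sum_congr rfl fun j _ => ?_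
    have hval := fun k => h.integral_backlog_mul_comp_S t k (some b)
      fun s => ψ b s j / net.prob (some b) s
    rw [integral_sub (hint j b j) (hint (some b) b j), hval, hval]
    simp_rw [hψ.prob_mul_div]
    ring
  rw [heq, sum_flow_mul_sub (fun b j => ∑ s, ψ b s j) (fun j => ∫ ω, X.backlog μ t ω j ∂P)
    (by simp [backlog]), ← Finset.sum_neg_distrib]
  refine Finset.sum_le_sum fun a _ => ?_
  have h0 : 0 ≤ ∫ ω, X.backlog μ t ω (some a) ∂P :=
    integral_nonneg fun ω => X.backlog_nonneg μ t ω _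
  rw [Finset.sum_comm (f := fun j s => ψ a s j)]
  have := hψ.balance a
  nlinarith

/-- The Lyapunov drift of backpressure. -/
theorem IsBackpressure.integral_sq_succ_le [IsProbabilityMeasure P] {R : ℕ → Ω → RankOrdering N}
    (h : X.IsBackpressure μ R) {δ Amax : ℝ} {ψ : Fin N → Finset (Node N) → Node N → ℝ}
    (hψ : StationaryRouting net lam δ ψ) (hA : ∀ t ω a, X.A t ω a ≤ Amax) (t : ℕ) :
    ∫ ω, ∑ a, X.backlog μ (t + 1) ω (some a) ^ 2 ∂P ≤
      ∫ ω, ∑ a, X.backlog μ t ω (some a) ^ 2 ∂P + N * (1 + (N + 1 + Amax) ^ 2) -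
        2 * δ * ∑ a, ∫ ω, X.backlog μ t ω (some a) ∂P := by
  have hpol := h.priority.policy
  have hsq : ∀ t, Integrable (fun ω => ∑ a, X.backlog μ t ω (some a) ^ 2) P := fun t =>
    integrable_finsetSum _ fun a _ => (hpol.memLp_backlog t (some a)).integrable_sq
  have hqA : Integrable (fun ω => ∑ a, X.backlog μ t ω (some a) * X.A t ω a) P :=
    integrable_finsetSum _ fun a _ => hpol.integrable_backlog_mul_arrival t a
  have hD := hpol.integrable_stationaryDrift ψ t
  have hpt : ∀ ω, ∑ a, X.backlog μ (t + 1) ω (some a) ^ 2 ≤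
      ∑ a, X.backlog μ t ω (some a) ^ 2 + N * (1 + (N + 1 + Amax) ^ 2) +
        2 * (∑ a, X.backlog μ t ω (some a) * X.A t ω a + X.stationaryDrift μ ψ t ω) := by
    intro ω
    have h1 := Finset.sum_le_sum fun (a : Fin N) (_ : a ∈ Finset.univ) =>
      hpol.sq_backlog_succ_le hA t ω a
    have h2 := h.drift_le hψ t ω
    simp only [Finset.sum_add_distrib, ← Finset.mul_sum, Finset.sum_const, Finset.card_univ,
      Fintype.card_fin, nsmul_eq_mul] at h1
    linarith
  have hmono := integral_mono (hsq (t + 1))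
    (((hsq t).fun_add (integrable_const _)).fun_add ((hqA.fun_add hD).const_mul 2)) hpt
  have hexp : ∫ ω, (∑ a, X.backlog μ t ω (some a) ^ 2 + N * (1 + (N + 1 + Amax) ^ 2) +
        2 * (∑ a, X.backlog μ t ω (some a) * X.A t ω a + X.stationaryDrift μ ψ t ω)) ∂P =
      ∫ ω, ∑ a, X.backlog μ t ω (some a) ^ 2 ∂P + N * (1 + (N + 1 + Amax) ^ 2) +
        2 * (∑ a, (∫ ω, X.backlog μ t ω (some a) ∂P) * lam a +
          ∫ ω, X.stationaryDrift μ ψ t ω ∂P) := by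
    rw [integral_add ((hsq t).fun_add (integrable_const _)) ((hqA.fun_add hD).const_mul 2),
      integral_add (hsq t) (integrable_const _), integral_const_mul (2 : ℝ), integral_add hqA hD,
      integral_finsetSum _ fun a _ => hpol.integrable_backlog_mul_arrival t a]
    simp_rw [hpol.integral_backlog_mul_arrival]
    simp
  have hdrift := hpol.integral_stationaryDrift_le hψ t
  simp only [mul_add, Finset.sum_add_distrib, ← Finset.sum_mul] at hdrift
  refine hmono.trans ?_
  rw [hexp]
  linarith

theorem IsBackpressure.stabilizes [IsProbabilityMeasure P] {R : ℕ → Ω → RankOrdering N}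
    (h : X.IsBackpressure μ R) {δ : ℝ} (hδ : 0 < δ) {ψ : Fin N → Finset (Node N) → Node N → ℝ}
    (hψ : StationaryRouting net lam δ ψ) : X.Stabilizes μ := by
  obtain ⟨Amax, hA⟩ := X.A_bdd
  have hpol := h.priority.policy
  set L : ℕ → ℝ := fun t => ∫ ω, ∑ a, X.backlog μ t ω (some a) ^ 2 ∂P with hL
  set B : ℝ := N * (1 + (N + 1 + Amax) ^ 2) with hB
  have hL0 : ∀ t, 0 ≤ L t := fun t =>
    integral_nonneg fun ω => Finset.sum_nonneg fun a _ => sq_nonneg _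
  have hB0 : 0 ≤ B := by positivity
  have hE0 : ∀ t a, 0 ≤ ∫ ω, X.backlog μ t ω (some a) ∂P := fun t a =>
    integral_nonneg fun ω => X.backlog_nonneg μ t ω _
  have hsum : ∀ T : ℕ, L T + 2 * δ * ∑ t ∈ Finset.range T, ∑ a, ∫ ω, X.backlog μ t ω (some a) ∂P ≤
      L 0 + T * B := by
    intro T
    induction T with
    | zero => simp
    | succ T ih =>
      have := h.integral_sq_succ_le hψ hA T
      rw [Finset.sum_range_succ, mul_add]
      push_cast
      linarith
  intro a
  -- The constant comes from dividing the telescoped drift by `2 * δ * T` and using `L 0 / T ≤ L 0`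
  -- for `T ≥ 1`.
  refine lt_of_le_of_lt (Filter.limsup_le_of_le (by isBoundedDefault)
    (Filter.Eventually.of_forall fun T => ?_) (a := ENNReal.ofReal ((L 0 + B) / (2 * δ))))
    ENNReal.ofReal_lt_top
  have hlint : ∀ t, ∫⁻ ω, ENNReal.ofReal (X.Q μ t ω a) ∂P =
      ENNReal.ofReal (∫ ω, X.backlog μ t ω (some a) ∂P) := fun t =>
    (ofReal_integral_eq_lintegral_ofReal (hpol.integrable_backlog t (some a))
      (Filter.Eventually.of_forall fun ω => X.backlog_nonneg μ t ω _)).symm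
  simp_rw [hlint]
  rw [← ENNReal.ofReal_sum_of_nonneg fun t _ => hE0 t a]
  -- For `T = 0` the average is `0 / 0 = 0` in `ENNReal`.
  rcases Nat.eq_zero_or_pos T with rfl | hT
  · simp
  have hT' : (1 : ℝ) ≤ T := by exact_mod_cast hT
  refine ENNReal.div_le_of_le_mul ?_
  rw [← ENNReal.ofReal_natCast, ← ENNReal.ofReal_mul (by have := hL0 0; positivity)]
  refine ENNReal.ofReal_le_ofReal ?_
  rw [div_mul_eq_mul_div, le_div_iff₀ (by positivity)]
  have h1 : ∑ t ∈ Finset.range T, ∫ ω, X.backlog μ t ω (some a) ∂P ≤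
      ∑ t ∈ Finset.range T, ∑ a, ∫ ω, X.backlog μ t ω (some a) ∂P :=
    Finset.sum_le_sum fun t _ => Finset.single_le_sum (f := fun a => ∫ ω, X.backlog μ t ω (some a) ∂P)
      (fun a _ => hE0 t a) (Finset.mem_univ a)
  have h2 := hsum T
  have h3 := hL0 T
  have h4 := hL0 0
  nlinarith

end Scenario

/-! ### A scenario with integer arrivals and prescribed rates. -/

section IntegerScenario

variable {N : ℕ} (net : Network N) (lam : Fin N → ℝ)

/-- The law of the set of nodes that have the packet after a transmission by `i`. -/
noncomputable def forwarderLaw (i : Node N) : Measure (Finset (Node N)) :=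
  ∑ s, ENNReal.ofReal (net.prob i s) • Measure.dirac s

theorem forwarderLaw_apply (i : Node N) (B : Set (Finset (Node N))) [DecidablePred (· ∈ B)] :
    forwarderLaw net i B = ENNReal.ofReal (∑ s, if s ∈ B then net.prob i s else 0) := by
  rw [forwarderLaw, Measure.finsetSum_apply, ENNReal.ofReal_sum_of_nonneg]
  · refine Finset.sum_congr rfl fun s _ => ?_
    by_cases hs : s ∈ B <;> simp [hs, Set.indicator]
  · intro s _
    split_ifs
    · exact net.prob_nonneg i s
    · exact le_rfl

instance (i : Node N) : IsProbabilityMeasure (forwarderLaw net i) := by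
  classical
  refine ⟨?_⟩
  rw [forwarderLaw_apply]
  simp [net.prob_sum]

/-- The law of the fractional part of the arrivals. -/
noncomputable def coinLaw (a : Fin N) : Measure Bool :=
  ENNReal.ofReal (Int.fract (lam a)) • Measure.dirac true +
    ENNReal.ofReal (1 - Int.fract (lam a)) • Measure.dirac false

instance (a : Fin N) : IsProbabilityMeasure (coinLaw lam a) := by
  refine ⟨?_⟩
  have h0 := Int.fract_nonneg (lam a)
  have h1 := (Int.fract_lt_one (lam a)).le
  simp only [coinLaw, Measure.add_apply, Measure.smul_apply, measure_univ, smul_eq_mul, mul_one]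
  rw [← ENNReal.ofReal_add h0 (by linarith)]
  simp

/-- The law of the randomness of one slot. -/
noncomputable def slotLaw : Measure ((Node N → Finset (Node N)) × (Fin N → Bool)) :=
  (Measure.pi (forwarderLaw net)).prod (Measure.pi (coinLaw lam))

instance : IsProbabilityMeasure (slotLaw net lam) := by
  unfold slotLaw
  infer_instance

/-- The arrivals of one slot: the integer part of the rate plus a coin flip. -/
noncomputable def slotArrival (e : (Node N → Finset (Node N)) × (Fin N → Bool)) (a : Fin N) : ℝ :=
  ⌊lam a⌋₊ + if e.2 a then 1 else 0

/-- The potential forwarders of one slot. -/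
def slotForwarders (e : (Node N → Finset (Node N)) × (Fin N → Bool)) (i : Node N) :
    Finset (Node N) :=
  insert i (e.1 i)

theorem measurable_slotArrival : Measurable (slotArrival lam) := by
  refine measurable_pi_lambda _ fun a => measurable_const.add ?_
  exact (measurable_of_countable fun b : Bool => if b then (1 : ℝ) else 0).comp
    ((measurable_pi_apply a).comp measurable_snd)

theorem measurable_slotForwarders : Measurable (slotForwarders (N := N)) := by
  refine measurable_pi_lambda _ fun i => ?_
  exact (measurable_of_countable fun s : Finset (Node N) => insert i s).comp
    ((measurable_pi_apply i).comp measurable_fst)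

theorem integral_slotArrival (hlam : ∀ a, 0 ≤ lam a) (a : Fin N) :
    ∫ e, slotArrival lam e a ∂(slotLaw net lam) = lam a := by
  have hmp : MeasurePreserving (fun e : (Node N → Finset (Node N)) × (Fin N → Bool) => e.2 a)
      (slotLaw net lam) (coinLaw lam a) :=
    (measurePreserving_eval (coinLaw lam) a).comp measurePreserving_snd
  have h1 : ∫ e, slotArrival lam e a ∂(slotLaw net lam) =
      ∫ b, ((⌊lam a⌋₊ : ℝ) + if b then 1 else 0) ∂(coinLaw lam a) := by
    rw [← hmp.map_eq, integral_map hmp.measurable.aemeasurable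
      (measurable_of_countable _).aestronglyMeasurable]
    rfl
  have h0 := Int.fract_nonneg (lam a)
  have h2 := (Int.fract_lt_one (lam a)).le
  have h3 : (⌊lam a⌋₊ : ℝ) = (⌊lam a⌋ : ℝ) := by
    exact_mod_cast congrArg (Int.cast (R := ℝ)) (Int.natCast_floor_eq_floor (hlam a))
  rw [h1, coinLaw, integral_add_measure (Integrable.of_finite.smul_measure ENNReal.ofReal_ne_top)
    (Integrable.of_finite.smul_measure ENNReal.ofReal_ne_top)]
  simp only [integral_smul_measure, integral_dirac, ENNReal.toReal_ofReal h0,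
    ENNReal.toReal_ofReal (sub_nonneg.2 h2), smul_eq_mul, h3]
  simp only [if_true, Bool.false_eq_true, if_false]
  linarith [Int.floor_add_fract (lam a)]

/-- Inserting the transmitter makes its membership sure rather than almost sure. It leaves the law
unchanged because sets without the transmitter have probability zero. -/
theorem slotLaw_forwarders (i : Node N) (s : Finset (Node N)) :
    (slotLaw net lam).real {e | slotForwarders e i = s} = net.prob i s := by
  classical
  have hmp : MeasurePreserving (fun e : (Node N → Finset (Node N)) × (Fin N → Bool) => e.1 i)
      (slotLaw net lam) (forwarderLaw net i) :=
    (measurePreserving_eval (forwarderLaw net) i).comp measurePreserving_fst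
  have h := hmp.measureReal_preimage
    (MeasurableSet.of_discrete (s := {u | insert i u = s})).nullMeasurableSet
  refine h.trans ?_
  rw [Measure.real, forwarderLaw_apply, ENNReal.toReal_ofReal]
  · have : ∀ u, (if u ∈ {u | insert i u = s} then net.prob i u else 0) =
        if u = s then net.prob i u else 0 := by
      intro u
      by_cases hu : net.prob i u = 0
      · simp [hu]
      · simp [Finset.insert_eq_of_mem (net.prob_self i u hu)]
    simp_rw [this]
    simp
  · refine Finset.sum_nonneg fun u _ => ?_
    split_ifs
    · exact net.prob_nonneg i u
    · exact le_rfl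

/-- A scenario with integer arrivals and empty initial backlogs. -/
noncomputable def integerScenario (hlam : ∀ a, 0 ≤ lam a) :
    Scenario net lam (Measure.infinitePi fun _ : ℕ => slotLaw net lam) where
  Q₀ _ _ := 0
  A t ω := slotArrival lam (ω t)
  S t ω := slotForwarders (ω t)
  measurable_Q₀ := measurable_const
  measurable_A t := (measurable_slotArrival lam).comp (measurable_pi_apply t)
  measurable_S t := measurable_slotForwarders.comp (measurable_pi_apply t)
  Q₀_nonneg _ _ := le_rfl
  Q₀_sq _ := memLp_const 0
  A_nonneg t ω a := by
    unfold slotArrival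
    positivity
  A_bdd := by
    refine ⟨∑ a, (⌊lam a⌋₊ : ℝ) + 1, fun t ω a => ?_⟩
    have h1 : (⌊lam a⌋₊ : ℝ) ≤ ∑ a, (⌊lam a⌋₊ : ℝ) :=
      Finset.single_le_sum (f := fun a => (⌊lam a⌋₊ : ℝ)) (fun _ _ => by positivity)
        (Finset.mem_univ a)
    unfold slotArrival
    split_ifs <;> linarith
  A_ident t := by
    have h : ∀ t, IdentDistrib (fun ω : ℕ → (Node N → Finset (Node N)) × (Fin N → Bool) => ω t) id
        (Measure.infinitePi fun _ : ℕ => slotLaw net lam) (slotLaw net lam) := fun t =>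
      ⟨(measurable_pi_apply t).aemeasurable, measurable_id.aemeasurable,
        (measurePreserving_eval_infinitePi (fun _ : ℕ => slotLaw net lam) t).map_eq.trans
          Measure.map_id.symm⟩
    exact ((h t).trans (h 0).symm).comp (measurable_slotArrival lam)
  A_mean a := by
    rw [← integral_slotArrival net lam hlam a]
    have hmp := measurePreserving_eval_infinitePi (fun _ : ℕ => slotLaw net lam) 0
    conv_rhs => rw [← hmp.map_eq]
    rw [integral_map hmp.measurable.aemeasurable]
    exact ((measurable_pi_apply a).comp (measurable_slotArrival lam)).aestronglyMeasurable
  S_self t ω i := Finset.mem_insert_self _ _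
  S_law t i s := by
    have hmp := measurePreserving_eval_infinitePi (fun _ : ℕ => slotLaw net lam) t
    rw [← slotLaw_forwarders net lam i s]
    refine hmp.measureReal_preimage (s := {e | slotForwarders e i = s})
      (MeasurableSet.nullMeasurableSet ?_)
    exact (measurable_pi_apply i).comp measurable_slotForwarders (measurableSet_singleton s)
  indep_time :=
    iIndepFun_infinitePi (P := fun _ : ℕ => slotLaw net lam)
      (X := fun _ e => (slotArrival lam e, slotForwarders e))
      fun _ => (measurable_slotArrival lam).prodMk measurable_slotForwarders
  indep_init := indepFun_const_left _ _

end IntegerScenario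

/-! ### Packet conservation and stationary routing from a stabilizing policy. -/

/-- A sequence with bounded averages is somewhere small compared with its index. -/
theorem exists_le_mul_of_average_le {u : ℕ → ℝ} (hu : ∀ t, 0 ≤ u t) {C δ : ℝ} (hδ : 0 < δ)
    (h : ∀ᶠ T : ℕ in Filter.atTop, ∑ t ∈ Finset.range T, u t ≤ C * T) :
    ∃ T : ℕ, 0 < T ∧ u T ≤ δ * T := by
  -- Otherwise the terms with index in `[T, 2T)` alone sum to at least `δ * T ^ 2`, exceeding the
  -- bound `2 * C * T` once `T > 2 * C / δ`.
  by_contra! hcon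
  obtain ⟨T₀, hT₀⟩ := Filter.eventually_atTop.1 h
  obtain ⟨n, hn⟩ := exists_nat_gt (2 * C / δ)
  set T := max T₀ (n + 1) with hT
  have hTpos : 0 < T := lt_of_lt_of_le n.succ_pos (le_max_right _ _)
  have h1 := hT₀ (T + T) ((le_max_left _ _).trans (Nat.le_add_left _ _))
  rw [Finset.sum_range_add] at h1
  have h2 : 0 ≤ ∑ t ∈ Finset.range T, u t := Finset.sum_nonneg fun t _ => hu t
  have h3 : ∑ t ∈ Finset.range T, δ * (T : ℝ) ≤ ∑ t ∈ Finset.range T, u (T + t) := by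
    refine Finset.sum_le_sum fun t _ => ?_
    have h4 := (hcon (T + t) (by omega)).le
    have h5 : (T : ℝ) ≤ ((T + t : ℕ) : ℝ) := by exact_mod_cast Nat.le_add_right T t
    exact (mul_le_mul_of_nonneg_left h5 hδ.le).trans h4
  rw [Finset.sum_const, Finset.card_range, nsmul_eq_mul] at h3
  push_cast at h1
  have hTr : (0 : ℝ) < T := by exact_mod_cast hTpos
  have h6 : (T : ℝ) * (δ * T) ≤ T * (2 * C) := by linarith
  have h7 := le_of_mul_le_mul_left h6 hTr
  have h8 : (n : ℝ) ≤ T := by exact_mod_cast n.le_succ.trans (le_max_right T₀ (n + 1))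
  rw [div_lt_iff₀ hδ] at hn
  nlinarith

namespace Scenario

variable {N : ℕ} {net : Network N} {lam : Fin N → ℝ} {Ω : Type} [MeasurableSpace Ω]
  {P : Measure Ω} {X : Scenario net lam P} {μ : Decisions N Ω}

/-- The number of packets that actually move from `i` to `j`. -/
noncomputable def flow (X : Scenario net lam P) (μ : Decisions N Ω) (t : ℕ) (ω : Ω)
    (i j : Node N) : ℝ :=
  (μ t ω i j : ℝ) * if (μ t ω i j : ℝ) ≤ X.backlog μ t ω i then 1 else 0

theorem flow_nonneg (X : Scenario net lam P) (μ : Decisions N Ω) (t : ℕ) (ω : Ω) (i j : Node N) :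
    0 ≤ X.flow μ t ω i j := by
  unfold flow
  positivity

theorem flow_le (X : Scenario net lam P) (μ : Decisions N Ω) (t : ℕ) (ω : Ω) (i j : Node N) :
    X.flow μ t ω i j ≤ μ t ω i j := by
  unfold flow
  split_ifs <;> simp

theorem backlog_natural (hQ : ∀ ω a, X.Q₀ ω a = 0) (hA : ∀ t ω a, ∃ n : ℕ, X.A t ω a = n)
    (t : ℕ) (ω : Ω) (i : Node N) : ∃ n : ℕ, X.backlog μ t ω i = n := by
  induction t generalizing i with
  | zero =>
    cases i with
    | none => exact ⟨0, by simp [backlog]⟩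
    | some a => exact ⟨0, by simp [backlog, hQ]⟩
  | succ t ih =>
    cases i with
    | none => exact ⟨0, by simp [backlog]⟩
    | some a =>
      choose q hq using ih
      obtain ⟨n, hn⟩ := hA t ω a
      refine ⟨(q (some a) - ∑ j, μ t ω (some a) j) +
        ∑ j, μ t ω j (some a) * (if μ t ω j (some a) ≤ q j then 1 else 0) + n, ?_⟩
      simp only [backlog, hq, hn]
      push_cast
      congr 2
      swap
      · simp only [Nat.cast_le]
      rcases le_total (∑ j, μ t ω (some a) j) (q (some a)) with h | h
      · rw [Nat.cast_sub h, max_eq_left]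
        · push_cast
          rfl
        · have : ((∑ j, μ t ω (some a) j : ℕ) : ℝ) ≤ q (some a) := by exact_mod_cast h
          push_cast at this
          linarith
      · rw [Nat.sub_eq_zero_of_le h, max_eq_right]
        · simp
        · have : (q (some a) : ℝ) ≤ ((∑ j, μ t ω (some a) j : ℕ) : ℝ) := by exact_mod_cast h
          push_cast at this
          linarith

/-- No packets are lost when all backlogs are integers. -/
theorem IsRoutingPolicy.backlog_succ_eq (h : X.IsRoutingPolicy μ) (hQ : ∀ ω a, X.Q₀ ω a = 0)
    (hA : ∀ t ω a, ∃ n : ℕ, X.A t ω a = n) (t : ℕ) (ω : Ω) (a : Fin N) :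
    X.backlog μ (t + 1) ω (some a) = X.backlog μ t ω (some a) - ∑ j, X.flow μ t ω (some a) j +
      ∑ b, X.flow μ t ω (some b) (some a) + X.A t ω a := by
  have hin : ∑ j, X.flow μ t ω j (some a) = ∑ b, X.flow μ t ω (some b) (some a) := by
    rw [Fintype.sum_option]
    simp [flow, h.decision_none]
  rw [← hin, backlog]
  congr 2
  obtain ⟨n, hn⟩ := backlog_natural (μ := μ) hQ hA t ω (some a)
  have hsum := h.sum_cast_le_one t ω (some a)
  unfold flow
  rw [hn]
  -- An empty queue moves nothing. With at least one packet the positive part is inactive and every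
  -- decision is carried out. A backlog strictly between 0 and 1 could instead be lost, hence the
  -- integrality assumption.
  rcases Nat.eq_zero_or_pos n with rfl | hpos
  · have hz : ∀ j, (μ t ω (some a) j : ℝ) *
        (if (μ t ω (some a) j : ℝ) ≤ ((0 : ℕ) : ℝ) then 1 else 0) = 0 := by
      intro j
      split_ifs with hj
      · have : μ t ω (some a) j = 0 := by exact_mod_cast Nat.le_zero.1 (by exact_mod_cast hj)
        simp [this]
      · simp
    rw [Finset.sum_congr rfl fun j _ => hz j, max_eq_right]
    · simp
    · have : (0 : ℝ) ≤ ∑ j, (μ t ω (some a) j : ℝ) := Finset.sum_nonneg fun j _ => by positivity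
      rw [Nat.cast_zero]
      linarith
  · have hn1 : (1 : ℝ) ≤ n := by exact_mod_cast hpos
    rw [max_eq_left (by linarith)]
    congr 1
    refine Finset.sum_congr rfl fun j _ => ?_
    rw [if_pos ((h.decision_le_one t ω _ j).trans hn1), mul_one]

theorem IsRoutingPolicy.measurable_flow (h : X.IsRoutingPolicy μ) (t : ℕ) (i j : Node N) :
    Measurable fun ω => X.flow μ t ω i j := by
  have hg : Measurable fun p : ℝ × ℝ => p.1 * if p.1 ≤ p.2 then (1 : ℝ) else 0 :=
    measurable_fst.mul (Measurable.ite (measurableSet_le measurable_fst measurable_snd)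
      measurable_const measurable_const)
  exact hg.comp (((measurable_of_countable (fun n : ℕ => (n : ℝ))).comp
    (h.measurable_decision t i j)).prodMk (h.measurable_backlog t i))

theorem measurableSet_S_eq (X : Scenario net lam P) (t : ℕ) (i : Node N) (s : Finset (Node N)) :
    MeasurableSet {ω | X.S t ω i = s} :=
  (measurable_pi_apply i).comp (X.measurable_S t) (measurableSet_singleton s)

theorem IsRoutingPolicy.integrable_flow [IsProbabilityMeasure P] (h : X.IsRoutingPolicy μ) (t : ℕ)
    (i j : Node N) : Integrable (fun ω => X.flow μ t ω i j) P := by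
  refine Integrable.of_bound (h.measurable_flow t i j).aestronglyMeasurable 1
    (Filter.Eventually.of_forall fun ω => ?_)
  rw [Real.norm_of_nonneg (X.flow_nonneg μ t ω i j)]
  exact (X.flow_le μ t ω i j).trans (h.decision_le_one t ω i j)

/-- The expected flow from `b` to `j` in slot `t` while the potential forwarders of `b` are `s`. -/
noncomputable def meanFlow (X : Scenario net lam P) (μ : Decisions N Ω) (t : ℕ) (b : Fin N)
    (s : Finset (Node N)) (j : Node N) : ℝ :=
  ∫ ω in {ω | X.S t ω (some b) = s}, X.flow μ t ω (some b) j ∂P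

theorem IsRoutingPolicy.sum_meanFlow [IsProbabilityMeasure P] (h : X.IsRoutingPolicy μ) (t : ℕ)
    (b : Fin N) (j : Node N) :
    ∑ s, X.meanFlow μ t b s j = ∫ ω, X.flow μ t ω (some b) j ∂P := by
  unfold meanFlow
  rw [← integral_iUnion_fintype (fun s => X.measurableSet_S_eq t (some b) s) ?_
    fun s => (h.integrable_flow t (some b) j).integrableOn]
  · have : ⋃ s, {ω | X.S t ω (some b) = s} = Set.univ := by
      ext ω
      simp
    rw [this, Measure.restrict_univ]
  · intro s s' hs
    rw [Function.onFun, Set.disjoint_left]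
    intro ω hω hω'
    exact hs (hω.symm.trans hω')

theorem meanFlow_nonneg (X : Scenario net lam P) (μ : Decisions N Ω) (t : ℕ) (b : Fin N)
    (s : Finset (Node N)) (j : Node N) : 0 ≤ X.meanFlow μ t b s j :=
  integral_nonneg fun ω => X.flow_nonneg μ t ω _ _

theorem IsRoutingPolicy.meanFlow_eq_zero (h : X.IsRoutingPolicy μ) (t : ℕ) (b : Fin N)
    {s : Finset (Node N)} {j : Node N} (hj : j ∉ s) : X.meanFlow μ t b s j = 0 := by
  refine setIntegral_eq_zero_of_forall_eq_zero fun ω hω => ?_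
  have hω : X.S t ω (some b) = s := hω
  have := h.le_indicator t ω (some b) j
  rw [hω, if_neg hj, Nat.le_zero] at this
  simp [flow, this]

theorem IsRoutingPolicy.sum_meanFlow_le [IsProbabilityMeasure P] (h : X.IsRoutingPolicy μ) (t : ℕ)
    (b : Fin N) (s : Finset (Node N)) : ∑ j, X.meanFlow μ t b s j ≤ net.prob (some b) s := by
  unfold meanFlow
  rw [← integral_finsetSum _ fun j _ => (h.integrable_flow t (some b) j).integrableOn,
    ← X.S_law t (some b) s]
  calc ∫ ω in {ω | X.S t ω (some b) = s}, ∑ j, X.flow μ t ω (some b) j ∂P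
      ≤ ∫ ω in {ω | X.S t ω (some b) = s}, (1 : ℝ) ∂P := by
        refine integral_mono (integrable_finsetSum _ fun j _ =>
          (h.integrable_flow t (some b) j).integrableOn) (integrable_const _) fun ω => ?_
        exact (Finset.sum_le_sum fun j _ => X.flow_le μ t ω (some b) j).trans
          (h.sum_cast_le_one t ω (some b))
    _ = _ := by simp

theorem IsRoutingPolicy.integral_backlog_succ [IsProbabilityMeasure P] (h : X.IsRoutingPolicy μ)
    (hQ : ∀ ω a, X.Q₀ ω a = 0) (hA : ∀ t ω a, ∃ n : ℕ, X.A t ω a = n) (t : ℕ) (a : Fin N) :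
    ∫ ω, X.backlog μ (t + 1) ω (some a) ∂P = ∫ ω, X.backlog μ t ω (some a) ∂P -
      ∑ j, ∑ s, X.meanFlow μ t a s j + ∑ b, ∑ s, X.meanFlow μ t b s (some a) + lam a := by
  have hout : Integrable (fun ω => ∑ j, X.flow μ t ω (some a) j) P :=
    integrable_finsetSum _ fun j _ => h.integrable_flow t (some a) j
  have hin : Integrable (fun ω => ∑ b, X.flow μ t ω (some b) (some a)) P :=
    integrable_finsetSum _ fun b _ => h.integrable_flow t (some b) (some a)
  have hAi : Integrable (fun ω => X.A t ω a) P := by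
    obtain ⟨Amax, hAmax⟩ := X.A_bdd
    refine Integrable.of_bound (X.measurable_arrival t a).aestronglyMeasurable Amax
      (Filter.Eventually.of_forall fun ω => ?_)
    rw [Real.norm_of_nonneg (X.A_nonneg t ω a)]
    exact hAmax t ω a
  have hb := h.integrable_backlog t (some a)
  simp_rw [h.backlog_succ_eq hQ hA, h.sum_meanFlow]
  rw [integral_add ((hb.sub' hout).fun_add hin) hAi, integral_add (hb.sub' hout) hin,
    integral_sub hb hout, X.integral_arrival,
    integral_finsetSum _ fun j _ => h.integrable_flow t (some a) j,
    integral_finsetSum _ fun b _ => h.integrable_flow t (some b) (some a)]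

/-- A stabilizing policy has integrated backlogs with bounded averages. -/
theorem IsRoutingPolicy.eventually_sum_le [IsProbabilityMeasure P] (h : X.IsRoutingPolicy μ)
    (hstab : X.Stabilizes μ) (a : Fin N) :
    ∃ C : ℝ, ∀ᶠ T : ℕ in Filter.atTop,
      ∑ t ∈ Finset.range T, ∫ ω, X.backlog μ t ω (some a) ∂P ≤ C * T := by
  obtain ⟨c, hc, -⟩ := ENNReal.lt_iff_exists_nnreal_btwn.1 (hstab a)
  refine ⟨c, ?_⟩
  filter_upwards [Filter.eventually_lt_of_limsup_lt hc (by isBoundedDefault),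
    Filter.eventually_gt_atTop 0] with T hT hTpos
  have hlint : ∀ t, ∫⁻ ω, ENNReal.ofReal (X.Q μ t ω a) ∂P =
      ENNReal.ofReal (∫ ω, X.backlog μ t ω (some a) ∂P) := fun t =>
    (ofReal_integral_eq_lintegral_ofReal (h.integrable_backlog t (some a))
      (Filter.Eventually.of_forall fun ω => X.backlog_nonneg μ t ω _)).symm
  simp_rw [hlint] at hT
  rw [← ENNReal.ofReal_sum_of_nonneg fun t _ => integral_nonneg fun ω =>
    X.backlog_nonneg μ t ω _] at hT
  have hT0 : (T : ENNReal) ≠ 0 := by exact_mod_cast hTpos.ne'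
  have h1 := (ENNReal.div_lt_iff (Or.inl hT0) (Or.inl (ENNReal.natCast_ne_top T))).1 hT
  have h2 : (c : ENNReal) * (T : ENNReal) = ENNReal.ofReal (c * T) := by
    rw [ENNReal.ofReal_mul c.coe_nonneg, ENNReal.ofReal_coe_nnreal, ENNReal.ofReal_natCast]
  rw [h2] at h1
  exact (ENNReal.ofReal_le_ofReal_iff (by positivity)).1 h1.le

/-- A stabilizing policy in a scenario without losses yields stationary randomized routing. -/
theorem IsRoutingPolicy.exists_stationaryRouting [IsProbabilityMeasure P]
    (h : X.IsRoutingPolicy μ) (hQ : ∀ ω a, X.Q₀ ω a = 0)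
    (hA : ∀ t ω a, ∃ n : ℕ, X.A t ω a = n) (hstab : X.Stabilizes μ) {δ : ℝ} (hδ : 0 < δ) :
    ∃ ψ, StationaryRouting net lam (-δ) ψ := by
  set e : ℕ → Fin N → ℝ := fun t a => ∫ ω, X.backlog μ t ω (some a) ∂P with he
  have he0 : ∀ t a, 0 ≤ e t a := fun t a => integral_nonneg fun ω => X.backlog_nonneg μ t ω _
  choose C hC using h.eventually_sum_le hstab
  -- One horizon must serve all nodes, so the total mean backlog is used.
  obtain ⟨T, hT, heT⟩ := exists_le_mul_of_average_le (u := fun t => ∑ a, e t a) (C := ∑ a, C a)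
    (fun t => Finset.sum_nonneg fun a _ => he0 t a) hδ (by
      filter_upwards [Filter.eventually_all.2 hC] with T hT
      rw [Finset.sum_comm, Finset.sum_mul]
      exact Finset.sum_le_sum fun a _ => hT a)
  have hTr : (0 : ℝ) < T := by exact_mod_cast hT
  -- Mean flows are joint, not conditional, quantities, so the feasibility constraints are linear
  -- and survive averaging over time. The balance is the telescoped conservation law: its deficit at
  -- `a` is `e T a / T ≤ δ`.
  refine ⟨fun b s j => (∑ t ∈ Finset.range T, X.meanFlow μ t b s j) / T, ?_, ?_, ?_, ?_⟩
  · exact fun b s j => div_nonneg (Finset.sum_nonneg fun t _ => X.meanFlow_nonneg μ t b s j) hTr.le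
  · intro b s j hj
    simp [h.meanFlow_eq_zero _ b hj]
  · intro b s
    rw [← Finset.sum_div, div_le_iff₀ hTr, Finset.sum_comm]
    calc ∑ t ∈ Finset.range T, ∑ j, X.meanFlow μ t b s j
        ≤ ∑ t ∈ Finset.range T, net.prob (some b) s :=
          Finset.sum_le_sum fun t _ => h.sum_meanFlow_le t b s
      _ = _ := by simp [mul_comm]
  · intro a
    have htel : ∀ T : ℕ, e T a = T * lam a -
        ∑ t ∈ Finset.range T, ∑ j, ∑ s, X.meanFlow μ t a s j +
        ∑ t ∈ Finset.range T, ∑ b, ∑ s, X.meanFlow μ t b s (some a) := by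
      intro T
      induction T with
      | zero => simp [he, backlog, hQ]
      | succ T ih =>
        have := h.integral_backlog_succ hQ hA T a
        rw [Finset.sum_range_succ, Finset.sum_range_succ]
        simp only [he] at ih ⊢
        rw [this, ih]
        push_cast
        ring
    have hle : e T a ≤ δ * T :=
      (Finset.single_le_sum (f := fun a => e T a) (fun a _ => he0 T a) (Finset.mem_univ a)).trans heT
    rw [htel] at hle
    have h1 : ∑ b, ∑ s, (∑ t ∈ Finset.range T, X.meanFlow μ t b s (some a)) / (T : ℝ) =
        (∑ t ∈ Finset.range T, ∑ b, ∑ s, X.meanFlow μ t b s (some a)) / T := by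
      simp_rw [← Finset.sum_div]
      congr 1
      symm
      rw [Finset.sum_comm]
      exact Finset.sum_congr rfl fun b _ => Finset.sum_comm
    have h2 : ∑ s, ∑ j, (∑ t ∈ Finset.range T, X.meanFlow μ t a s j) / (T : ℝ) =
        (∑ t ∈ Finset.range T, ∑ j, ∑ s, X.meanFlow μ t a s j) / T := by
      simp_rw [← Finset.sum_div]
      congr 1
      symm
      rw [Finset.sum_comm]
      exact (Finset.sum_congr rfl fun j _ => Finset.sum_comm).trans Finset.sum_comm
    rw [h1, h2, ← sub_nonneg]
    have h3 : ∀ x y : ℝ, y / T - (lam a + -δ + x / T) = (y - (T * lam a - δ * T + x)) / T := by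
      intro x y
      field_simp
      ring
    rw [h3]
    exact div_nonneg (by linarith) hTr.le

end Scenario

/-! ### Spare capacity in the interior, and the theorem. -/

theorem StationaryRouting.of_add {N : ℕ} {net : Network N} {lam : Fin N → ℝ} {δ ε : ℝ}
    {ψ : Fin N → Finset (Node N) → Node N → ℝ}
    (h : StationaryRouting net (fun a => lam a + ε) δ ψ) : StationaryRouting net lam (ε + δ) ψ :=
  ⟨h.nonneg, h.support, h.sum_le, fun a => by linarith [h.balance a]⟩

theorem exists_stationaryRouting_of_mem_interior {N : ℕ} {net : Network N} {lam : Fin N → ℝ}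
    (hlam : lam ∈ interior (stabilityRegion net)) :
    ∃ δ > 0, ∃ ψ, StationaryRouting net lam δ ψ := by
  obtain ⟨ε, hε, hball⟩ := Metric.isOpen_iff.1 isOpen_interior lam hlam
  -- Raising all rates by `ε / 2` stays in the region. The averaged flows lose at most `ε / 4` of
  -- this, so spare capacity `ε / 4` remains.
  have hmem : (fun a => lam a + ε / 2) ∈ stabilityRegion net := by
    refine interior_subset (hball ?_)
    rw [Metric.mem_ball]
    refine lt_of_le_of_lt ((dist_pi_le_iff (by positivity)).2 fun a => ?_) (half_lt_self hε)
    rw [Real.dist_eq, add_sub_cancel_left, abs_of_pos (half_pos hε)]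
  -- The region requires a stabilizing policy for every arrival process with the given rates, so a
  -- lossless one may be chosen here; the original scenario need not be integral.
  obtain ⟨μ, hμ, hstab⟩ := hmem.2 _ _ (integerScenario net _ hmem.1)
  obtain ⟨ψ, hψ⟩ := hμ.exists_stationaryRouting (fun _ _ => rfl)
    (fun t ω a => by
      refine ⟨⌊lam a + ε / 2⌋₊ + if (ω t).2 a then 1 else 0, ?_⟩
      simp [integerScenario, slotArrival]) hstab (δ := ε / 4) (by positivity)
  exact ⟨ε / 2 + -(ε / 4), by linarith, ψ, hψ.of_add⟩

theorem backpressureThroughputOptimal {N : ℕ} (net : Network N) :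
    BackpressureThroughputOptimal net := by
  intro lam hlam Ω _ P _ X μ R h
  obtain ⟨δ, hδ, ψ, hψ⟩ := exists_stationaryRouting_of_mem_interior hlam
  exact h.stabilizes hδ hψ

theorem mainTheorem6 {N : ℕ} (net : Network N) :
    -- for every `f` satisfying (C1) and (C2):
    (∀ f : ℕ → ℕ → ℝ, (∀ m n, 0 < n → 0 < f m n) → CondC1 f → CondC2 f →
      -- where the `f`-policy is defined
      (∀ Q : Fin N → ℝ, (∀ a, 0 ≤ Q a) → ∃ R, IsPi TieRule.coarser f Q R) ∧
      (∀ Q : Fin N → ℝ, (∀ a, 0 ≤ Q a) → Function.Injective Q → ∃ R, IsPi TieRule.finer f Q R) ∧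
      -- a lower rank under the `f`-policy means a smaller backlog
      (∀ (τ : TieRule) (Q : Fin N → ℝ) (R : RankOrdering N), IsPi τ f Q R →
        ∀ j k, R.Lt j k → Q j < Q k) ∧
      (∀ (τ : TieRule) (Q : Fin N → ℝ) (R : RankOrdering N), Q ∈ cone τ f R →
        ∀ j k, R.Lt j k → Q j ≤ Q k) ∧
      -- backpressure respects the `f`-policy
      (∀ (lam : Fin N → ℝ) (Ω : Type) [MeasurableSpace Ω] (P : Measure Ω) [IsProbabilityMeasure P]
        (X : Scenario net lam P) (μ : Decisions N Ω) (Rb : ℕ → Ω → RankOrdering N),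
        X.IsBackpressure μ Rb →
          (∃ R : ℕ → Ω → RankOrdering N,
            (∀ t ω, IsPi TieRule.coarser f (X.Q μ t ω) (R t ω)) ∧ Respects Rb R) ∧
          (∀ (t : ℕ) (ω : Ω) (R : RankOrdering N),
            IsPi TieRule.finer f (X.Q μ t ω) R → (Rb t ω).Refines R))) ∧
    -- DIVBAR is a priority-based policy of backpressure type
    (∀ (lam : Fin N → ℝ) (Ω : Type) [MeasurableSpace Ω] (P : Measure Ω) [IsProbabilityMeasure P]
      (X : Scenario net lam P) (μ : Decisions N Ω),
      X.IsDIVBAR μ → ∃ Rb : ℕ → Ω → RankOrdering N, X.IsBackpressure μ Rb) ∧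
    -- throughput optimality
    BackpressureThroughputOptimal net := by
  refine ⟨fun f h0 h1 h2 => ⟨fun Q hQ => exists_isPi_coarser h0 h1 h2 hQ,
    fun Q hQ hinj => exists_isPi_finer h0 h1 h2 hQ hinj,
    fun τ Q R hR j k hjk => lt_of_isPi h0 h1 h2 hR hjk,
    fun τ Q R hR j k hjk => (FLt_of_mem_cone h0 h1 h2 hR hjk).le, ?_⟩, ?_,
    backpressureThroughputOptimal net⟩
  · intro lam Ω _ P _ X μ Rb hRb
    refine ⟨?_, fun t ω R hR a b hab => hRb.smaller_lower t ω a b (lt_of_isPi h0 h1 h2 hR hab)⟩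
    choose R hR using fun t ω => exists_isPi_coarser h0 h1 h2 (X.Q_nonneg μ t ω)
    exact ⟨R, hR, fun t ω a b hab =>
      hRb.smaller_lower t ω a b (lt_of_isPi h0 h1 h2 (hR t ω) hab)⟩
  · intro lam Ω _ P _ X μ h
    exact ⟨_, h.isBackpressure⟩
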